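/- Let $M$ be a compact (connected, non-empty, boundaryless) smooth Riemannian manifold with induced distance $\operatorname{dist}$, and let $m$ (Lebesgue measure) be the Riemannian volume normalized to $m(M)=1$. Let $f\colon M\to M$ be continuous, and let $\mathcal S\subset M$ be a compact submanifold with $\dim\mathcal S<\dim M$ (possibly $\mathcal S=\emptyset$) such that $f$ is a $C^2$ local diffeomorphism on $M\setminus\mathcal S$. Let $\beta>0$, and suppose that, if $\mathcal S\neq\emptyset$, $f$ behaves like a power of the distance to $\mathcal S$ with exponent $\beta$: there is $B>1$ such that 1. $B^{-1}\operatorname{dist}(x,\mathcal S)^{\beta}\|v\|\le\|Df(x)v\|\le B\operatorname{dist}(x,\mathcal S)^{-\beta}\|v\|$ for all $x\in M\setminus\mathcal S$ and $v\in T_xM$; 2. $\bigl|\log\|Df(x)^{-1}\|-\log\|Df(y)^{-1}\|\bigr|\le B\,\operatorname{dist}(x,y)/\operatorname{dist}(x,\mathcal S)^{\beta}$, 3. $\bigl|\log|\det Df(x)^{-1}|-\log|\det Df(y)^{-1}|\bigr|\le B\,\operatorname{dist}(x,y)/\operatorname{dist}(x,\mathcal S)^{\beta}$, the last two for all $x,y\in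 M\setminus\mathcal S$ with $\operatorname{dist}(x,y)<\operatorname{dist}(x,\mathcal S)/2$. Fix $0<b<\min\{1/2,1/(4\beta)\}$. For $\delta>0$ put $\operatorname{dist}_\delta(x,\mathcal S)=\operatorname{dist}(x,\mathcal S)$ if $\operatorname{dist}(x,\mathcal S)\le\delta$ and $\operatorname{dist}_\delta(x,\mathcal S)=1$ otherwise (in particular if $\mathcal S=\emptyset$). For $0<\sigma<1$ and $\delta>0$, an integer $n\ge1$ is a $(\sigma,\delta)$-hyperbolic time for $x\in M$ if for every $1\le k\le n$ $$\prod_{j=n-k}^{n-1}\|Df(f^j(x))^{-1}\|\le\sigma^k\quad\text{and}\quad\operatorname{dist}_\delta(f^{n-k}(x),\mathcal S)\ge\sigma^{bk}.$$ Suppose that for some $0<\sigma<1$ and $\delta>0$ the following holds: $m$-almost every point has a $(\sigma,\delta)$-hyperbolic time, and the function $h$ which assigns to $x$ its first $(\sigma,\delta)$-hyperbolic time is integrable with respect to $m$. Then $f$ has an invariant probability measure $\mu$ which is absolutely continuous with respect to $m$; moreover $\mu$ can be chosen as the weak* limit of a subsequence of the Cesàro averages $\frac1n\sum_{j=0}^{n-1}f^j_*m$.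 -/

import Mathlib

open Set Filter Topology MeasureTheory Manifold Bundle
open scoped ENNReal ContDiff

noncomputable section

/-- `S` is an embedded smooth submanifold (without boundary) of the `d`-dimensional manifold `M`,
all of whose components have dimension `< d`: around each of its points there is a smooth chart of
`M` in which `S` is the slice `{v | v i = 0 for all i ≥ k}` with some `k < d`. The empty set is
allowed. -/
def IsLowerDimSubmanifold (d : ℕ) {M : Type*} [TopologicalSpace M]
    [ChartedSpace (EuclideanSpace ℝ (Fin d)) M] (S : Set M) : Prop :=
  ∀ p ∈ S, ∃ k < d, ∃ e ∈ IsManifold.maximalAtlas (𝓡 d) ∞ M,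
    p ∈ e.source ∧
      ∀ q ∈ e.source, q ∈ S ↔ ∀ i : Fin d, k ≤ (i : ℕ) → e q i = 0

/-- The truncated distance to `S`: it is `dist (x, S)` if `dist (x, S) ≤ δ` and `1` otherwise.
The distance to the empty set is infinite, so the value is `1` when `S = ∅`. -/
def truncDist {M : Type*} [MetricSpace M] (δ : ℝ) (x : M) (S : Set M) : ℝ :=
  open Classical in
  if S.Nonempty ∧ Metric.infDist x S ≤ δ then Metric.infDist x S else 1

section Riemannian

variable {d : ℕ} {M : Type*} [MetricSpace M] [ChartedSpace (EuclideanSpace ℝ (Fin d)) M]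
  [RiemannianBundle (fun x : M ↦ TangentSpace (𝓡 d) x)]

/-- The `i`-th standard basis vector of `ℝ^d`, seen in the tangent space of `M` at `x`, which
is `ℝ^d` as a vector space. -/
def tangentBasisVec (x : M) (i : Fin d) : TangentSpace (𝓡 d) x :=
  (EuclideanSpace.single i (1 : ℝ) : EuclideanSpace ℝ (Fin d))

/-- The absolute value of the determinant of a linear map between two tangent spaces, with respect
to their inner products: the factor by which it multiplies `d`-dimensional volume, computed as
the ratio of the volumes of the parallelepipeds spanned by the images of a basis and by the basis. -/
def absDet {x y : M} (L : TangentSpace (𝓡 d) x →L[ℝ] TangentSpace (𝓡 d) y) : ℝ :=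
  √(Matrix.gram ℝ (fun i : Fin d ↦ L (tangentBasisVec x i))).det /
    √(Matrix.gram ℝ (fun i : Fin d ↦ (tangentBasisVec x i : TangentSpace (𝓡 d) x))).det

/-- The inverse `Df(x)⁻¹ : T_{f x} M → T_x M` of the derivative of `f` at `x`
(zero if the derivative is not invertible). -/
def derivInv (f : M → M) (x : M) :
    TangentSpace (𝓡 d) (f x) →L[ℝ] TangentSpace (𝓡 d) x :=
  (mfderiv (𝓡 d) (𝓡 d) f x).inverse

variable (d) in
/-- The `i`-th coordinate vector field `∂_i` of the preferred chart at `p`, at the point of `M` with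
coordinates `y`: the image of the `i`-th basis vector of `ℝ^d` under the derivative at `y` of the
inverse of the chart. -/
def chartFrame (p : M) (y : EuclideanSpace ℝ (Fin d)) (i : Fin d) :
    TangentSpace (𝓡 d) ((extChartAt (𝓡 d) p).symm y) :=
  letI : ChartedSpace (EuclideanSpace ℝ (Fin d)) (EuclideanSpace ℝ (Fin d)) := chartedSpaceSelf _
  mfderiv (𝓡 d) (𝓡 d) (extChartAt (𝓡 d) p).symm y
    (EuclideanSpace.single i (1 : ℝ) : EuclideanSpace ℝ (Fin d))

variable (d) in
/-- The density `√ det (g_ij)` of the Riemannian volume in the preferred chart at `p`, where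
`g_ij = ⟨∂_i, ∂_j⟩`. -/
def chartDensity (p : M) (y : EuclideanSpace ℝ (Fin d)) : ℝ :=
  √(Matrix.gram ℝ (chartFrame d p y)).det

variable (d) in
/-- The Riemannian volume on the domain of the preferred chart at `p`, as a measure on `M`:
the image of `√ det (g_ij) dy` under the inverse of the chart. -/
def chartVolume [MeasurableSpace M] (p : M) : Measure M :=
  Measure.map (extChartAt (𝓡 d) p).symm
    ((volume.restrict (extChartAt (𝓡 d) p).target).withDensity
      (fun y ↦ ENNReal.ofReal (chartDensity d p y)))

variable (d M) in
/-- The Riemannian volume measure of `M`: the smallest measure which is at least the volume of each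
chart, that is, the measure which on the domain of each chart agrees with the volume there. -/
def riemannianVolume [MeasurableSpace M] : Measure M :=
  ⨆ p : M, chartVolume d p

variable (d M) in
/-- Lebesgue measure on `M`: the Riemannian volume normalized to have total mass one. -/
def lebesgueMeasure [MeasurableSpace M] : Measure M :=
  (riemannianVolume d M univ)⁻¹ • riemannianVolume d M

variable (d) in
/-- `f` behaves like a power (with exponent `β`) of the distance to `S`:
the standard non-degeneracy conditions on the exceptional set `S`.
They say nothing if `S` is empty. -/
structure IsNondegenerate (f : M → M) (S : Set M) (β : ℝ) : Prop where
  pos : 0 < β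
  bounds : S.Nonempty → ∃ B : ℝ, 1 < B ∧
    (∀ x ∉ S, ∀ v : TangentSpace (𝓡 d) x,
      B⁻¹ * Metric.infDist x S ^ β * ‖v‖ ≤ ‖mfderiv (𝓡 d) (𝓡 d) f x v‖ ∧
      ‖mfderiv (𝓡 d) (𝓡 d) f x v‖ ≤ B * Metric.infDist x S ^ (-β) * ‖v‖) ∧
    (∀ x ∉ S, ∀ y ∉ S, dist x y < Metric.infDist x S / 2 →
      |Real.log ‖derivInv (d := d) f x‖ - Real.log ‖derivInv (d := d) f y‖| ≤
        B * dist x y / Metric.infDist x S ^ β) ∧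
    (∀ x ∉ S, ∀ y ∉ S, dist x y < Metric.infDist x S / 2 →
      |Real.log (absDet (derivInv (d := d) f x)) - Real.log (absDet (derivInv (d := d) f y))| ≤
        B * dist x y / Metric.infDist x S ^ β)

variable (d) in
/-- `n ≥ 1` is a `(σ, δ)`-hyperbolic time for `x` (with parameter `b`). The second condition
implies that `x, f x, …, f^(n-1) x` are not in `S`, so that the derivatives are invertible. -/
def IsHyperbolicTime (f : M → M) (S : Set M) (b σ δ : ℝ) (n : ℕ) (x : M) : Prop :=
  1 ≤ n ∧ ∀ k, 1 ≤ k → k ≤ n →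
    ∏ j ∈ Finset.Ico (n - k) n, ‖derivInv (d := d) f (f^[j] x)‖ ≤ σ ^ k ∧
    σ ^ (b * (k : ℝ)) ≤ truncDist δ (f^[n - k] x) S

variable (d) in
/-- The first `(σ, δ)`-hyperbolic time of `x` (`0` if there is none). -/
def firstHyperbolicTime (f : M → M) (S : Set M) (b σ δ : ℝ) (x : M) : ℕ :=
  sInf {n | IsHyperbolicTime d f S b σ δ n x}

end Riemannian

/-- The Cesàro averages `n⁻¹ ∑_{j < n} f^j_* m`. -/
def cesaroAverage {M : Type*} [MeasurableSpace M] (f : M → M) (m : Measure M) (n : ℕ) :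
    Measure M :=
  (n : ℝ≥0∞)⁻¹ • ∑ j ∈ Finset.range n, m.map f^[j]

end

/-! At a hyperbolic time $n$ of $x$ the iterate $f^n$ has an inverse branch, defined on a
neighborhood $B$ of $f^n(x)$ that can be taken from a finite list independent of $n$, and its volume
distortion is bounded independently of $n$. To build it, contract $B$ to $f^n(x)$ along
$\rho$-Lipschitz paths and lift this homotopy backwards through $f$, one iterate at a time. With
$\sigma=s^4$, the lift at time $n-k$ stays within $\rho s^{2k}$ of $f^{n-k}(x)$. Since $b<1/2$ and
$b<1/(4\beta)$, this radius is small compared with the distance to $\mathcal S$, so there $f$ is a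
local diffeomorphism, $\|Df^{-1}\|$ changes at most by a factor $s^{-1}$, and $\log|\det Df|$
oscillates by at most a multiple of $s^k$; the oscillations sum to a constant. This is
`exists_distortion_bound`, `exists_hasExpandingOrbit` and `HasExpandingOrbit.exists_branch`.

Branches over the same connected $B$ coincide or have disjoint images, so their distortion estimates
add up. If $H_n$ is the set of points having $n$ as a hyperbolic time, then $m(H_n\cap f^{-n}A)\le
C\,m(A)$ with $C$ independent of $n$ (`exists_measure_expandingOrbit_inter_preimage_le`).

Hyperbolic times concatenate. Hence, if $l$ is the last hyperbolic time of $x$ up to $n$, the point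
$f^l(x)$ has none in $[1,n-l]$. Splitting by $l$ gives $f^n_*m\le\eta:=(C+1)\sum_j
f^j_*(m|_{\{h>j\}})$ up to null sets, for every $n$ (`measure_preimage_iterate_le_sum`). The mass of
$\eta$ is $(C+1)\sum_j m(h>j)$, which is finite because $h$ is integrable, and $\eta\ll m$ because
$f$ is nonsingular. All Cesàro averages lie below $\eta$; so does any weak* limit of them, and such
a limit is invariant.

The remaining work is Riemannian: derivative bounds give Lipschitz bounds, the determinant of $Df$
is the Jacobian for the volume, and the volume is finite, positive on open sets and zero on
$\mathcal S$. -/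

noncomputable section

/-! ### Lifting paths and homotopies through a locally expanding map -/

section Lifting

variable {M : Type*} [MetricSpace M]

/-- `f` is backward `κ`-Lipschitz near `y`. -/
def IsLocallyExpandingAt (f : M → M) (κ : ℝ) (y : M) : Prop :=
  ∃ U ∈ 𝓝 y, ∀ u ∈ U, ∀ v ∈ U, dist u v ≤ κ * dist (f u) (f v)

/-- Compactness makes the size of the local inverses uniform. This $\varepsilon$ fixes the step
length when paths are lifted. -/
theorem exists_uniform_local_section {f : M → M} {S K : Set M} {κ : ℝ} (hK : IsCompact K)
    (hf : IsLocalHomeomorphOn f Sᶜ)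
    (hKS : ∀ y ∈ K, y ∉ S ∧ IsLocallyExpandingAt f κ y) :
    ∃ ε > 0, ∀ y ∈ K, ∃ U : Set M, y ∈ U ∧
      (∀ u ∈ U, ∀ v ∈ U, dist u v ≤ κ * dist (f u) (f v)) ∧ Metric.ball (f y) ε ⊆ f '' U := by
  refine hK.induction_on (p := fun K ↦ ∃ ε > 0, ∀ y ∈ K, ∃ U : Set M, y ∈ U ∧
      (∀ u ∈ U, ∀ v ∈ U, dist u v ≤ κ * dist (f u) (f v)) ∧ Metric.ball (f y) ε ⊆ f '' U)
    ⟨1, one_pos, by simp⟩ ?_ ?_ ?_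
  · rintro s t hst ⟨ε, hε, h⟩
    exact ⟨ε, hε, fun y hy ↦ h y (hst hy)⟩
  · rintro s t ⟨ε, hε, h⟩ ⟨ε', hε', h'⟩
    refine ⟨min ε ε', lt_min hε hε', fun y hy ↦ ?_⟩
    rcases hy with hy | hy
    · obtain ⟨U, h1, h2, h3⟩ := h y hy
      exact ⟨U, h1, h2, (Metric.ball_subset_ball (min_le_left _ _)).trans h3⟩
    · obtain ⟨U, h1, h2, h3⟩ := h' y hy
      exact ⟨U, h1, h2, (Metric.ball_subset_ball (min_le_right _ _)).trans h3⟩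
  · intro y hy
    obtain ⟨hyS, U, hU, hUκ⟩ := hKS y hy
    have hfU : f '' U ∈ 𝓝 (f y) := by
      rw [← hf.map_nhds_eq hyS]; exact image_mem_map hU
    obtain ⟨ε, hε, hεU⟩ := Metric.mem_nhds_iff.1 hfU
    -- The set $U$ chosen for $y$ also serves every $w\in U$ with $f(w)$ within $\varepsilon/2$ of
    -- $f(y)$, at the price of halving the radius.
    refine ⟨U ∩ f ⁻¹' Metric.ball (f y) (ε / 2), mem_nhdsWithin_of_mem_nhds (inter_mem hU
      ((hf.continuousAt hyS).preimage_mem_nhds (Metric.ball_mem_nhds _ (half_pos hε)))),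
      ε / 2, half_pos hε, fun w hw ↦ ⟨U, hw.1, hUκ, fun v hv ↦ hεU ?_⟩⟩
    have h1 : dist (f w) (f y) < ε / 2 := hw.2
    have h2 : dist v (f w) < ε / 2 := hv
    rw [Metric.mem_ball]
    linarith [dist_triangle v (f w) (f y)]

/-- Lift in $N$ short pieces, each by a local inverse of uniform size. The lift is $\kappa
L$-Lipschitz, so it cannot leave the ball of radius $\kappa L$ around $z$, where the local inverses
are available; this keeps the induction going up to time 1. -/
theorem exists_path_lift {f : M → M} {S : Set M} {z : M} {κ L : ℝ} (hκ : 0 ≤ κ) (hL : 0 ≤ L)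
    (hf : IsLocalHomeomorphOn f Sᶜ) (hK : IsCompact (Metric.closedBall z (κ * L)))
    (hKS : ∀ y ∈ Metric.closedBall z (κ * L), y ∉ S ∧ IsLocallyExpandingAt f κ y)
    {γ : ℝ → M} (hγ0 : γ 0 = f z)
    (hγ : ∀ s ∈ Icc (0 : ℝ) 1, ∀ t ∈ Icc (0 : ℝ) 1, dist (γ s) (γ t) ≤ L * |s - t|) :
    ∃ Γ : ℝ → M, Γ 0 = z ∧ (∀ s ∈ Icc (0 : ℝ) 1, f (Γ s) = γ s) ∧
      ∀ s ∈ Icc (0 : ℝ) 1, ∀ t ∈ Icc (0 : ℝ) 1, dist (Γ s) (Γ t) ≤ κ * L * |s - t| := by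
  obtain ⟨ε, hε, H⟩ := exists_uniform_local_section hK hf hKS
  obtain ⟨N, hN⟩ := exists_nat_gt (L / ε)
  have hN0 : (0 : ℝ) < N := (div_nonneg hL hε.le).trans_lt hN
  have hstep : L * (1 / N) < ε := by
    rw [mul_one_div, div_lt_iff₀ hN0]; rwa [div_lt_iff₀ hε, mul_comm] at hN
  suffices P : ∀ i : ℕ, i ≤ N → ∃ Γ : ℝ → M, Γ 0 = z ∧
      (∀ s ∈ Icc (0 : ℝ) (i / N), f (Γ s) = γ s) ∧
      ∀ s ∈ Icc (0 : ℝ) (i / N), ∀ t ∈ Icc (0 : ℝ) (i / N),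
        dist (Γ s) (Γ t) ≤ κ * L * |s - t| by
    simpa [div_self hN0.ne'] using P N le_rfl
  intro i
  induction i with
  | zero =>
    intro _
    refine ⟨fun _ ↦ z, rfl, fun s hs ↦ ?_, fun s _ t _ ↦ ?_⟩
    · have : s = 0 := le_antisymm (by simpa using hs.2) hs.1
      rw [this, hγ0]
    · simp only [dist_self]; positivity
  | succ i ih =>
    intro hi
    obtain ⟨Γ, hΓ0, hΓf, hΓL⟩ := ih (by omega)
    set t₀ : ℝ := i / N with ht₀
    have ht₀0 : 0 ≤ t₀ := by positivity
    have ht₁ : ((i + 1 : ℕ) : ℝ) / N = t₀ + 1 / N := by push_cast; ring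
    have ht₁1 : t₀ + 1 / N ≤ 1 := by
      rw [← ht₁, div_le_one hN0]; exact_mod_cast hi
    have hN' : 0 < 1 / (N : ℝ) := by positivity
    rw [ht₁]
    have ht₀m : t₀ ∈ Icc 0 t₀ := ⟨ht₀0, le_rfl⟩
    have hyK : Γ t₀ ∈ Metric.closedBall z (κ * L) := by
      rw [Metric.mem_closedBall, ← hΓ0]
      refine (hΓL _ ht₀m _ ⟨le_rfl, ht₀0⟩).trans ?_
      rw [sub_zero, abs_of_nonneg ht₀0]
      exact mul_le_of_le_one_right (by positivity) (by linarith)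
    obtain ⟨U, hyU, hU, hball⟩ := H _ hyK
    have hex : ∀ s ∈ Icc t₀ (t₀ + 1 / N), ∃ u ∈ U, f u = γ s := by
      intro s hs
      apply hball
      rw [Metric.mem_ball, hΓf _ ht₀m]
      refine (hγ _ ⟨ht₀0.trans hs.1, hs.2.trans ht₁1⟩ _ ⟨ht₀0, by linarith⟩).trans_lt
        (lt_of_le_of_lt ?_ hstep)
      rw [abs_of_nonneg (by linarith [hs.1])]
      exact mul_le_mul_of_nonneg_left (by linarith [hs.2]) hL
    have : Nonempty M := ⟨z⟩
    choose! h hhU hhf using hex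
    have hUL : ∀ u ∈ U, ∀ v ∈ U, ∀ s ∈ Icc (0 : ℝ) (t₀ + 1 / N), ∀ t ∈ Icc (0 : ℝ) (t₀ + 1 / N),
        f u = γ s → f v = γ t → dist u v ≤ κ * L * |s - t| := by
      intro u hu v hv s hs t ht hus hvt
      refine (hU u hu v hv).trans ?_
      rw [hus, hvt, mul_assoc]
      exact mul_le_mul_of_nonneg_left
        (hγ _ ⟨hs.1, hs.2.trans ht₁1⟩ _ ⟨ht.1, ht.2.trans ht₁1⟩) hκ
    -- The old and new pieces meet at $t_0$, and $|s-t|=|s-t_0|+|t_0-t|$, so the Lipschitz constant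
    -- is not lost in gluing.
    have hmix : ∀ s ∈ Icc 0 t₀, ∀ t ∈ Icc t₀ (t₀ + 1 / N),
        dist (Γ s) (h t) ≤ κ * L * |s - t| := by
      intro s hs t ht
      have h1 := hΓL s hs t₀ ht₀m
      have h2 := hUL _ hyU _ (hhU t ht) t₀ ⟨ht₀0, by linarith⟩ t ⟨ht₀0.trans ht.1, ht.2⟩
        (hΓf _ ht₀m) (hhf t ht)
      refine (dist_triangle _ (Γ t₀) _).trans ((add_le_add h1 h2).trans_eq ?_)
      rw [abs_of_nonpos (by linarith [hs.2]), abs_of_nonpos (by linarith [ht.1]),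
        abs_of_nonpos (by linarith [hs.2, ht.1])]
      ring
    refine ⟨fun s ↦ if s ≤ t₀ then Γ s else h s, by simp [ht₀0, hΓ0], fun s hs ↦ ?_,
      fun s hs t ht ↦ ?_⟩
    · by_cases hst : s ≤ t₀
      · simpa [hst] using hΓf s ⟨hs.1, hst⟩
      · simpa [hst] using hhf s ⟨(not_le.1 hst).le, hs.2⟩
    · by_cases hst : s ≤ t₀ <;> by_cases htt : t ≤ t₀ <;> simp only [hst, htt, if_true, if_false]
      · exact hΓL s ⟨hs.1, hst⟩ t ⟨ht.1, htt⟩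
      · exact hmix s ⟨hs.1, hst⟩ t ⟨(not_le.1 htt).le, ht.2⟩
      · rw [dist_comm, abs_sub_comm]
        exact hmix t ⟨ht.1, htt⟩ s ⟨(not_le.1 hst).le, hs.2⟩
      · have hs' : s ∈ Icc t₀ (t₀ + 1 / N) := ⟨(not_le.1 hst).le, hs.2⟩
        have ht' : t ∈ Icc t₀ (t₀ + 1 / N) := ⟨(not_le.1 htt).le, ht.2⟩
        exact hUL _ (hhU s hs') _ (hhU t ht') s hs t ht (hhf s hs') (hhf t ht')

open unitInterval in
/-- Homotopies that are Lipschitz in time lift through a map that is expanding around a ball. -/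
theorem exists_homotopy_lift {A : Type*} [TopologicalSpace A] {f : M → M} {S : Set M} {z : M}
    {κ L : ℝ} (hκ : 0 ≤ κ) (hL : 0 ≤ L) (hS : IsClosed S)
    (hf : IsLocalHomeomorphOn f Sᶜ) (hK : IsCompact (Metric.closedBall z (κ * L)))
    (hKS : ∀ y ∈ Metric.closedBall z (κ * L), y ∉ S ∧ IsLocallyExpandingAt f κ y)
    (c : C(I × A, M)) (hc0 : ∀ a, c (0, a) = f z)
    (hc : ∀ a s t, dist (c (s, a)) (c (t, a)) ≤ L * |(s : ℝ) - t|) :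
    ∃ G : C(I × A, M), (∀ q, f (G q) = c q) ∧ (∀ a, G (0, a) = z) ∧
      ∀ a s t, dist (G (s, a)) (G (t, a)) ≤ κ * L * |(s : ℝ) - t| := by
  have hex : ∀ a : A, ∃ Γ : I → M, Γ 0 = z ∧ (∀ s, f (Γ s) = c (s, a)) ∧
      ∀ s t, dist (Γ s) (Γ t) ≤ κ * L * |(s : ℝ) - t| := by
    intro a
    obtain ⟨Γ, h0, h1, h2⟩ := exists_path_lift hκ hL hf hK hKS
      (γ := fun s ↦ c (projIcc 0 1 zero_le_one s, a))
      (by simp only [projIcc_left]; exact hc0 a) (by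
        intro s hs t ht
        refine (hc a _ _).trans_eq ?_
        rw [projIcc_of_mem _ hs, projIcc_of_mem _ ht])
    exact ⟨fun s ↦ Γ s, h0, fun s ↦ by simpa using h1 s s.2, fun s t ↦ h2 s s.2 t t.2⟩
  choose Γ h0 h1 h2 using hex
  have hmem : ∀ a s, Γ a s ∈ Sᶜ := by
    intro a s
    refine (hKS _ ?_).1
    rw [Metric.mem_closedBall, ← h0 a]
    refine (h2 a s 0).trans (mul_le_of_le_one_right (by positivity) ?_)
    simpa using (abs_of_nonneg s.2.1).trans_le s.2.2
  have hp : IsLocalHomeomorph (Sᶜ.domRestrict f) := by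
    rw [isLocalHomeomorph_iff_isLocalHomeomorphOn_univ]
    exact hf.comp
      hS.isOpen_compl.isOpenEmbedding_subtypeVal.isLocalHomeomorph.isLocalHomeomorphOn
      (fun x _ ↦ x.2)
  -- The paths were lifted separately for each $a$. Joint continuity is automatic for a local
  -- homeomorphism once each path and the initial points are continuous.
  have hcont : Continuous (fun q : I × A ↦ (⟨Γ q.2 q.1, hmem _ _⟩ : ↥Sᶜ)) := by
    refine hp.continuous_lift (T2Space.isSeparatedMap (Sᶜ.domRestrict f)) c ?_ ?_ ?_
    · ext q; exact h1 q.2 q.1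
    · exact Continuous.subtype_mk (by simpa only [h0] using (continuous_const : Continuous fun _ : A ↦ z)) _
    · intro a
      refine Continuous.subtype_mk ?_ _
      refine LipschitzWith.continuous (K := Real.toNNReal (κ * L)) ?_
      refine LipschitzWith.of_dist_le_mul fun s t ↦ ?_
      rw [Real.coe_toNNReal _ (by positivity)]
      exact h2 a s t
  exact ⟨⟨fun q ↦ Γ q.2 q.1, continuous_subtype_val.comp hcont⟩, fun q ↦ h1 _ _, h0, h2⟩

end Lifting

/-! ### Inverse branches of iterates and their distortion -/

section Branches

variable {M : Type*} [MetricSpace M]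

/-- The points whose first `n` iterates (from time `0` on) avoid `S`. -/
def avoidingOrbit (f : M → M) (S : Set M) (n : ℕ) : Set M := {w | ∀ j < n, f^[j] w ∉ S}

/-- Along the orbit of `x` up to time `n`, the map is expanding with rate `κ j` and has distortion
`ε j` on balls whose radius is `ρ` times the remaining contraction, with total distortion at
most `D`. -/
def HasExpandingOrbit (f : M → M) (S : Set M) (J : M → ℝ) (ρ D : ℝ) (n : ℕ) (x : M) : Prop :=
  ∃ κ ε : ℕ → ℝ, (∀ j, 0 ≤ κ j) ∧ (∀ j < n,
    ∀ y ∈ Metric.closedBall (f^[j] x) (ρ * ∏ i ∈ Finset.Ico j n, κ i),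
      y ∉ S ∧ IsLocallyExpandingAt f (κ j) y ∧
        |Real.log (J y) - Real.log (J (f^[j] x))| ≤ ε j) ∧
    ∑ j ∈ Finset.range n, ε j ≤ D

/-- `B` is contractible to any of its points along `ρ`-Lipschitz paths depending continuously on the
endpoint. -/
def IsShortlyContractible (ρ : ℝ) (B : Set M) : Prop :=
  ∀ u ∈ B, ∃ c : C(unitInterval × B, M), (∀ v, c (0, v) = u) ∧ (∀ v, c (1, v) = v) ∧
    (∀ v : B, (v : M) = u → ∀ t, c (t, v) = u) ∧
    ∀ v s t, dist (c (s, v)) (c (t, v)) ≤ ρ * |(s : ℝ) - t|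

theorem isOpen_avoidingOrbit {f : M → M} (hf : Continuous f) {S : Set M} (hS : IsClosed S) (n : ℕ) :
    IsOpen (avoidingOrbit f S n) := by
  have : avoidingOrbit f S n = ⋂ j ∈ Finset.range n, (f^[j]) ⁻¹' Sᶜ := by
    ext; simp [avoidingOrbit]
  rw [this]
  exact isOpen_biInter_finset fun j _ ↦ hS.isOpen_compl.preimage (hf.iterate j)

theorem isLocalHomeomorphOn_iterate {f : M → M} {S : Set M}
    (hf : IsLocalHomeomorphOn f Sᶜ) (n : ℕ) :
    IsLocalHomeomorphOn (f^[n]) (avoidingOrbit f S n) := by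
  induction n with
  | zero => exact (Homeomorph.refl M).isLocalHomeomorph.isLocalHomeomorphOn
  | succ n ih =>
    rw [Function.iterate_succ']
    exact hf.comp (ih.mono fun w hw j hj ↦ hw j (by omega)) fun w hw ↦ hw n (by omega)

theorem isLocalHomeomorph_iterate_restrict {f : M → M} (hfc : Continuous f) {S : Set M}
    (hS : IsClosed S) (hf : IsLocalHomeomorphOn f Sᶜ) (n : ℕ) :
    IsLocalHomeomorph ((avoidingOrbit f S n).domRestrict f^[n]) := by
  rw [isLocalHomeomorph_iff_isLocalHomeomorphOn_univ]
  exact (isLocalHomeomorphOn_iterate hf n).comp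
    (isOpen_avoidingOrbit hfc hS n).isOpenEmbedding_subtypeVal.isLocalHomeomorph.isLocalHomeomorphOn
    (fun x _ ↦ x.2)

/-- Uniqueness of lifts through an iterate. -/
theorem eq_of_iterate_comp_eq {A : Type*} [TopologicalSpace A] [PreconnectedSpace A] {f : M → M}
    (hfc : Continuous f) {S : Set M} (hS : IsClosed S) (hf : IsLocalHomeomorphOn f Sᶜ) {n : ℕ}
    {g g' : A → M} (hg : Continuous g) (hg' : Continuous g')
    (hgS : ∀ a, g a ∈ avoidingOrbit f S n) (hgS' : ∀ a, g' a ∈ avoidingOrbit f S n)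
    (h : ∀ a, f^[n] (g a) = f^[n] (g' a)) (a : A) (ha : g a = g' a) : g = g' := by
  have := (T2Space.isSeparatedMap ((avoidingOrbit f S n).domRestrict f^[n])).eq_of_comp_eq
    (isLocalHomeomorph_iterate_restrict hfc hS hf n).isLocallyInjective
    (hg.subtype_mk hgS) (hg'.subtype_mk hgS') (by ext a; exact h a) a (Subtype.ext ha)
  ext b
  exact congrArg Subtype.val (congrFun this b)

-- Lift backwards from time $n$: after $k$ lifts the homotopy starts at $f^{n-k}(x)$ and its
-- time-Lipschitz constant is $\rho$ times the product of the last $k$ rates. That constant is also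
-- the radius on which the hypotheses are assumed, so one more lift is possible.
open unitInterval in
theorem exists_iterate_homotopy_lift [CompactSpace M] {A : Type*} [TopologicalSpace A] {f : M → M}
    {S : Set M} (hS : IsClosed S) (hf : IsLocalHomeomorphOn f Sᶜ) {ρ : ℝ} (hρ : 0 ≤ ρ) {n : ℕ}
    {x : M} {κ : ℕ → ℝ} (hκ : ∀ j, 0 ≤ κ j)
    (h : ∀ j < n, ∀ y ∈ Metric.closedBall (f^[j] x) (ρ * ∏ i ∈ Finset.Ico j n, κ i),
      y ∉ S ∧ IsLocallyExpandingAt f (κ j) y)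
    (c : C(I × A, M)) (hc0 : ∀ a, c (0, a) = f^[n] x)
    (hc : ∀ a s t, dist (c (s, a)) (c (t, a)) ≤ ρ * |(s : ℝ) - t|) :
    ∃ G : C(I × A, M), (∀ q, f^[n] (G q) = c q) ∧ (∀ a, G (0, a) = x) ∧
      ∀ j < n, ∀ q, f^[j] (G q) ∈
        Metric.closedBall (f^[j] x) (ρ * ∏ i ∈ Finset.Ico j n, κ i) := by
  suffices P : ∀ k ≤ n, ∃ G : C(I × A, M), (∀ q, f^[k] (G q) = c q) ∧
      (∀ a, G (0, a) = f^[n - k] x) ∧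
      (∀ a s t, dist (G (s, a)) (G (t, a)) ≤
        ρ * (∏ i ∈ Finset.Ico (n - k) n, κ i) * |(s : ℝ) - t|) ∧
      ∀ j < k, ∀ q, f^[j] (G q) ∈
        Metric.closedBall (f^[n - k + j] x) (ρ * ∏ i ∈ Finset.Ico (n - k + j) n, κ i) by
    obtain ⟨G, h1, h2, -, h3⟩ := P n le_rfl
    exact ⟨G, h1, by simpa using h2, by simpa using h3⟩
  intro k
  induction k with
  | zero => intro _; exact ⟨c, fun q ↦ rfl, hc0, by simpa using hc, by simp⟩
  | succ k ih =>
    intro hk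
    obtain ⟨G, h1, h2, h3, h4⟩ := ih (by omega)
    set l := n - (k + 1) with hl
    have hlk : n - k = l + 1 := by omega
    rw [hlk] at h2 h3 h4
    have hln : l < n := by omega
    have hprod : ∏ i ∈ Finset.Ico l n, κ i = κ l * ∏ i ∈ Finset.Ico (l + 1) n, κ i :=
      Finset.prod_eq_prod_Ico_succ_bot hln _
    have hP : 0 ≤ ∏ i ∈ Finset.Ico (l + 1) n, κ i := Finset.prod_nonneg fun i _ ↦ hκ i
    have hrad : κ l * (ρ * ∏ i ∈ Finset.Ico (l + 1) n, κ i) =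
        ρ * ∏ i ∈ Finset.Ico l n, κ i := by rw [hprod]; ring
    obtain ⟨G', g1, g2, g3⟩ := exists_homotopy_lift (z := f^[l] x) (hκ l)
      (mul_nonneg hρ hP) hS hf
      Metric.isClosed_closedBall.isCompact (by rw [hrad]; exact h l hln) G
      (fun a ↦ by rw [h2, Function.iterate_succ_apply']) h3
    rw [hrad] at g3
    refine ⟨G', fun q ↦ by rw [Function.iterate_succ_apply, g1, h1], g2, g3, fun j hj q ↦ ?_⟩
    rcases j with _ | j
    · have := g3 q.2 q.1 0
      rw [g2] at this
      refine this.trans (mul_le_of_le_one_right ?_ ?_)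
      · rw [← hrad]; exact mul_nonneg (hκ l) (mul_nonneg hρ hP)
      · simpa using (abs_of_nonneg q.1.2.1).trans_le q.1.2.2
    · rw [Function.iterate_succ_apply, g1]
      have := h4 j (by omega) q
      rwa [show l + 1 + j = l + (j + 1) by ring] at this

/-- Around a point with an expanding orbit there is an inverse branch of the iterate. -/
theorem HasExpandingOrbit.exists_section [CompactSpace M] {f : M → M} (hfc : Continuous f)
    {S : Set M} (hS : IsClosed S) (hf : IsLocalHomeomorphOn f Sᶜ) {J : M → ℝ} {ρ D : ℝ}
    (hρ : 0 ≤ ρ) {n : ℕ} {x : M} {B : Set M} (hB : IsShortlyContractible ρ B)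
    (hx : HasExpandingOrbit f S J ρ D n x) (hxB : f^[n] x ∈ B) :
    ∃ g : B → M, Continuous g ∧ (∀ v, f^[n] (g v) = v) ∧ g ⟨_, hxB⟩ = x ∧
      (∀ v, g v ∈ avoidingOrbit f S n) ∧ ∃ ε : ℕ → ℝ, ∑ j ∈ Finset.range n, ε j ≤ D ∧
      (∀ j < n, f^[j] x ∉ S) ∧
      ∀ v, ∀ j < n, |Real.log (J (f^[j] (g v))) - Real.log (J (f^[j] x))| ≤ ε j := by
  obtain ⟨κ, ε, hκ, h, hε⟩ := hx
  obtain ⟨c, hc0, hc1, hcu, hc⟩ := hB _ hxB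
  obtain ⟨G, G1, G2, G3⟩ := exists_iterate_homotopy_lift hS hf hρ hκ
    (fun j hj y hy ↦ ⟨(h j hj y hy).1, (h j hj y hy).2.1⟩) c hc0 hc
  have hav : ∀ q, G q ∈ avoidingOrbit f S n := fun q j hj ↦ (h j hj _ (G3 j hj q)).1
  have hxS : x ∈ avoidingOrbit f S n := by
    have := hav (0, ⟨_, hxB⟩)
    rwa [G2] at this
  refine ⟨fun v ↦ G (1, v), by fun_prop, fun v ↦ by rw [G1, hc1], ?_, fun v ↦ hav _, ε, hε,
    hxS, fun v j hj ↦ (h j hj _ (G3 j hj _)).2.2⟩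
  -- The contraction fixes its centre $f^n(x)$, so the lifted path over that point is constant and
  -- the branch sends $f^n(x)$ back to $x$.
  have := eq_of_iterate_comp_eq (A := unitInterval) hfc hS hf (n := n)
    (g := fun t ↦ G (t, ⟨_, hxB⟩)) (g' := fun _ ↦ x) (by fun_prop) continuous_const
    (fun t ↦ hav _) (fun _ ↦ hxS) (fun t ↦ by rw [G1, hcu _ rfl]) 0 (G2 _)
  exact congrFun this 1

variable [MeasurableSpace M] [BorelSpace M]

/-- The measure `m` of images under `f` is controlled by the Jacobian `J` off `S`. -/
def IsJacobian (f : M → M) (S : Set M) (m : Measure M) (J : M → ℝ) : Prop :=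
  ∀ A, MeasurableSet A → A ⊆ Sᶜ → InjOn f A → ∀ a : ℝ,
    ((∀ x ∈ A, a ≤ J x) → ENNReal.ofReal a * m A ≤ m (f '' A)) ∧
    ((∀ x ∈ A, J x ≤ a) → m (f '' A) ≤ ENNReal.ofReal a * m A)

/-- The one-step bounds multiply along the orbit. They can be iterated because $f^n(A)$ is again
measurable, being the image of a measurable set under a continuous map injective on it. -/
theorem IsJacobian.image_iterate [CompactSpace M] {f : M → M} (hfc : Continuous f) {S : Set M}
    {m : Measure M} {J : M → ℝ} (hJ : IsJacobian f S m J) (hJ0 : ∀ x ∉ S, 0 < J x)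
    {n : ℕ} {z : ℕ → M} {ε : ℕ → ℝ} {A : Set M} (hA : MeasurableSet A) (hinj : InjOn f^[n] A)
    (hz : ∀ j < n, z j ∉ S) (hAS : A ⊆ avoidingOrbit f S n)
    (h : ∀ y ∈ A, ∀ j < n, |Real.log (J (f^[j] y)) - Real.log (J (z j))| ≤ ε j) :
    ENNReal.ofReal (Real.exp (-∑ j ∈ Finset.range n, ε j) * ∏ j ∈ Finset.range n, J (z j)) * m A
      ≤ m (f^[n] '' A) ∧
    m (f^[n] '' A) ≤
      ENNReal.ofReal (Real.exp (∑ j ∈ Finset.range n, ε j) * ∏ j ∈ Finset.range n, J (z j)) *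
        m A := by
  induction n with
  | zero => simp
  | succ n ih =>
    have hinj' : InjOn f^[n] A := by
      intro u hu v hv huv
      apply hinj hu hv
      rw [Function.iterate_succ_apply', Function.iterate_succ_apply', huv]
    obtain ⟨l, u⟩ := ih hinj' (fun j hj ↦ hz j (by omega)) (fun w hw j hj ↦ hAS hw j (by omega))
      (fun y hy j hj ↦ h y hy j (by omega))
    have hmeas : MeasurableSet (f^[n] '' A) :=
      hA.image_of_continuousOn_injOn (hfc.iterate n).continuousOn hinj'
    have hsub : f^[n] '' A ⊆ Sᶜ := by
      rintro _ ⟨w, hw, rfl⟩; exact hAS hw n (by omega)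
    have hinjf : InjOn f (f^[n] '' A) := by
      rintro _ ⟨u, hu, rfl⟩ _ ⟨v, hv, rfl⟩ huv
      rw [← Function.iterate_succ_apply' f, ← Function.iterate_succ_apply' f] at huv
      rw [hinj hu hv huv]
    have hzn := hJ0 _ (hz n (by omega))
    have hJl := (hJ _ hmeas hsub hinjf (Real.exp (-ε n) * J (z n))).1 (by
      rintro _ ⟨y, hy, rfl⟩
      have hy0 := hJ0 _ (hAS hy n (by omega))
      have := (abs_le.1 (h y hy n (by omega))).1
      rw [← Real.exp_log hzn, ← Real.exp_add, ← Real.le_log_iff_exp_le hy0]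
      linarith)
    have hJu := (hJ _ hmeas hsub hinjf (Real.exp (ε n) * J (z n))).2 (by
      rintro _ ⟨y, hy, rfl⟩
      have hy0 := hJ0 _ (hAS hy n (by omega))
      have := (abs_le.1 (h y hy n (by omega))).2
      rw [← Real.exp_log hzn, ← Real.exp_add, ← Real.log_le_iff_le_exp hy0]
      linarith)
    have him : f^[n + 1] '' A = f '' (f^[n] '' A) := by
      rw [Function.iterate_succ', image_comp]
    have e1 : Real.exp (-∑ j ∈ Finset.range (n + 1), ε j) * ∏ j ∈ Finset.range (n + 1), J (z j)
        = (Real.exp (-ε n) * J (z n)) *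
          (Real.exp (-∑ j ∈ Finset.range n, ε j) * ∏ j ∈ Finset.range n, J (z j)) := by
      rw [Finset.sum_range_succ, Finset.prod_range_succ, neg_add, Real.exp_add]; ring
    have e2 : Real.exp (∑ j ∈ Finset.range (n + 1), ε j) * ∏ j ∈ Finset.range (n + 1), J (z j)
        = (Real.exp (ε n) * J (z n)) *
          (Real.exp (∑ j ∈ Finset.range n, ε j) * ∏ j ∈ Finset.range n, J (z j)) := by
      rw [Finset.sum_range_succ, Finset.prod_range_succ, Real.exp_add]; ring
    rw [e1, e2, him, ENNReal.ofReal_mul (p := Real.exp (-ε n) * J (z n)) (by positivity),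
      ENNReal.ofReal_mul (p := Real.exp (ε n) * J (z n)) (by positivity), mul_assoc, mul_assoc]
    exact ⟨(mul_le_mul_right l _).trans hJl, hJu.trans (mul_le_mul_right u _)⟩

/-- The domain of an inverse branch, with bounded distortion. -/
theorem HasExpandingOrbit.exists_branch [CompactSpace M] {f : M → M} (hfc : Continuous f)
    {S : Set M} (hS : IsClosed S) (hf : IsLocalHomeomorphOn f Sᶜ) {m : Measure M} {J : M → ℝ}
    (hJ : IsJacobian f S m J) (hJ0 : ∀ x ∉ S, 0 < J x) {ρ D : ℝ}
    (hρ : 0 ≤ ρ) {n : ℕ} {x : M} {B : Set M} (hBo : IsOpen B) (hB : IsShortlyContractible ρ B)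
    (hx : HasExpandingOrbit f S J ρ D n x) (hxB : f^[n] x ∈ B) :
    ∃ g : B → M, Continuous g ∧ (∀ v, f^[n] (g v) = v) ∧ x ∈ range g ∧
      (∀ v, g v ∈ avoidingOrbit f S n) ∧ IsOpen (range g) ∧
      ∀ A ⊆ B, MeasurableSet A → m (range g ∩ f^[n] ⁻¹' A) * m B ≤
        ENNReal.ofReal (Real.exp (2 * D)) * m A * m (range g) := by
  obtain ⟨g, gc, gf, gx, gS, ε, hε, hxS, hd⟩ := hx.exists_section hfc hS hf hρ hB hxB
  have hinj : InjOn f^[n] (range g) := by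
    rintro _ ⟨u, rfl⟩ _ ⟨v, rfl⟩ huv
    rw [gf, gf] at huv
    rw [Subtype.ext huv]
  -- Near $g(v)$ the map $f^n$ is injective; a nearby $w$ and $g(f^n(w))$ both lie in that region
  -- and have the same image, so $w=g(f^n(w))$.
  have hopen : IsOpen (range g) := by
    rw [isOpen_iff_mem_nhds]
    rintro _ ⟨v, rfl⟩
    obtain ⟨e, he, hef⟩ := isLocalHomeomorphOn_iterate hf n (g v) (gS v)
    have h1 : f^[n] ⁻¹' B ∈ 𝓝 (g v) :=
      (hBo.preimage (hfc.iterate n)).mem_nhds (by simp [gf])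
    obtain ⟨V, hV, hVe⟩ := mem_nhds_subtype _ _ _ |>.1
      (gc.continuousAt.preimage_mem_nhds (e.open_source.mem_nhds he))
    have h2 : f^[n] ⁻¹' V ∈ 𝓝 (g v) :=
      (hfc.iterate n).continuousAt.preimage_mem_nhds (by rwa [gf])
    filter_upwards [h1, h2, e.open_source.mem_nhds he] with w hwB hwV hwe
    refine ⟨⟨f^[n] w, hwB⟩, ?_⟩
    have h3 : g ⟨f^[n] w, hwB⟩ ∈ e.source := hVe hwV
    apply e.injOn h3 hwe
    rw [← hef, gf]
  refine ⟨g, gc, gf, ⟨_, gx⟩, gS, hopen, fun A hAB hA ↦ ?_⟩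
  set P := ∏ j ∈ Finset.range n, J (f^[j] x) with hP
  have hP0 : 0 < P := Finset.prod_pos fun j hj ↦ hJ0 _ (hxS j (by simpa using hj))
  have hD : ∀ y ∈ range g, ∀ j < n,
      |Real.log (J (f^[j] y)) - Real.log (J (f^[j] x))| ≤ ε j := by
    rintro _ ⟨v, rfl⟩; exact hd v
  have hav : range g ⊆ avoidingOrbit f S n := by rintro _ ⟨v, rfl⟩; exact gS v
  have hA' : MeasurableSet (range g ∩ f^[n] ⁻¹' A) :=
    hopen.measurableSet.inter ((hfc.iterate n).measurable hA)
  have l := (hJ.image_iterate hfc hJ0 (z := fun j ↦ f^[j] x) hA' (hinj.mono inter_subset_left) hxS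
    (inter_subset_left.trans hav) (fun y hy ↦ hD y hy.1)).1
  have u := (hJ.image_iterate hfc hJ0 (z := fun j ↦ f^[j] x) hopen.measurableSet hinj hxS
    hav hD).2
  have i1 : f^[n] '' (range g ∩ f^[n] ⁻¹' A) ⊆ A := by rintro _ ⟨w, hw, rfl⟩; exact hw.2
  have i2 : B ⊆ f^[n] '' range g := fun v hv ↦ ⟨g ⟨v, hv⟩, ⟨_, rfl⟩, gf _⟩
  rw [← hP] at l u
  set E := ∑ j ∈ Finset.range n, ε j with hE
  have l' := l.trans (measure_mono i1)
  have u' := (measure_mono i2).trans u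
  -- The product $P$ of Jacobians along the orbit of $x$ occurs in the lower bound for the image of
  -- the part over $A$ and in the upper bound for the image of the whole branch. It cancels and
  -- leaves $e^{2E}$.
  calc m (range g ∩ f^[n] ⁻¹' A) * m B
      ≤ m (range g ∩ f^[n] ⁻¹' A) * (ENNReal.ofReal (Real.exp E * P) * m (range g)) :=
        mul_le_mul_right u' _
    _ = ENNReal.ofReal (Real.exp (2 * E)) *
        (ENNReal.ofReal (Real.exp (-E) * P) * m (range g ∩ f^[n] ⁻¹' A)) * m (range g) := by
        have : Real.exp E * P = Real.exp (2 * E) * (Real.exp (-E) * P) := by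
          rw [← mul_assoc, ← Real.exp_add]; ring_nf
        rw [this, ENNReal.ofReal_mul (by positivity)]; ring
    _ ≤ ENNReal.ofReal (Real.exp (2 * D)) * m A * m (range g) := by
        gcongr

/-- Images under the `n`-th iterate of the points with an expanding orbit up to time `n` have
density bounded independently of `n`. -/
theorem exists_measure_expandingOrbit_inter_preimage_le [CompactSpace M] {f : M → M}
    (hfc : Continuous f) {S : Set M} (hS : IsClosed S) (hf : IsLocalHomeomorphOn f Sᶜ)
    {m : Measure M} [IsFiniteMeasure m] [m.IsOpenPosMeasure] {J : M → ℝ}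
    (hJ : IsJacobian f S m J) (hJ0 : ∀ x ∉ S, 0 < J x) {ρ D : ℝ} (hρ : 0 ≤ ρ)
    (hB : ∀ p : M, ∃ B : Set M, IsOpen B ∧ p ∈ B ∧ IsPreconnected B ∧ IsShortlyContractible ρ B) :
    ∃ C : ℝ≥0∞, C ≠ ⊤ ∧ ∀ n, ∀ A : Set M,
      m ({x | HasExpandingOrbit f S J ρ D n x} ∩ f^[n] ⁻¹' A) ≤ C * m A := by
  choose B hBo hpB hBc hBs using hB
  obtain ⟨t, -, ht⟩ := isCompact_univ.elim_nhds_subcover B (fun p _ ↦ (hBo p).mem_nhds (hpB p))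
  have hBpos : ∀ p, m (B p) ≠ 0 := fun p ↦ ((hBo p).measure_pos m ⟨p, hpB p⟩).ne'
  set C : M → ℝ≥0∞ := fun p ↦ ENNReal.ofReal (Real.exp (2 * D)) * m univ / m (B p) with hC
  have key : ∀ n p, ∀ A ⊆ B p, MeasurableSet A →
      m ({x | HasExpandingOrbit f S J ρ D n x} ∩ f^[n] ⁻¹' A) ≤ C p * m A := by
    intro n p A hAB hA
    have := isPreconnected_iff_preconnectedSpace.1 (hBc p)
    set H := {x | HasExpandingOrbit f S J ρ D n x} ∩ f^[n] ⁻¹' (B p) with hH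
    have hbr : ∀ x : H, _ := fun x ↦
      HasExpandingOrbit.exists_branch hfc hS hf hJ hJ0 hρ (hBo p) (hBs p) x.2.1 x.2.2
    choose g gc gf gx gS gop gm using hbr
    -- Two branches whose images meet agree at a point of $B$, hence everywhere, because $B$ is
    -- connected and lifts are unique.
    have heq : ∀ x y, (range (g x) ∩ range (g y)).Nonempty → g x = g y := by
      rintro x y ⟨w, ⟨u, hu⟩, ⟨v, hv⟩⟩
      have huv : u = v := Subtype.ext (by rw [← gf x u, ← gf y v, hu, hv])
      subst huv
      exact eq_of_iterate_comp_eq hfc hS hf (gc x) (gc y) (gS x) (gS y)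
        (fun a ↦ by rw [gf, gf]) u (hu.trans hv.symm)
    -- A set of images rather than a family indexed by points: each branch is counted once, and
    -- disjoint nonempty open sets are countably many.
    set W : Set (Set M) := range fun x : H ↦ range (g x) with hW
    have hdisj : W.PairwiseDisjoint id := by
      rintro _ ⟨x, rfl⟩ _ ⟨y, rfl⟩ hne
      by_contra hnd
      rw [Function.onFun, not_disjoint_iff_nonempty_inter] at hnd
      exact hne (by simp only [heq x y hnd])
    have hWc : W.Countable := by
      refine hdisj.countable_of_isOpen ?_ ?_
      · rintro _ ⟨x, rfl⟩; exact gop x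
      · rintro _ ⟨x, rfl⟩; exact ⟨_, gx x⟩
    have hcover : {x | HasExpandingOrbit f S J ρ D n x} ∩ f^[n] ⁻¹' A ⊆
        ⋃ w ∈ W, w ∩ f^[n] ⁻¹' A := by
      intro x hx
      exact mem_biUnion ⟨⟨x, hx.1, hAB hx.2⟩, rfl⟩ ⟨gx ⟨x, hx.1, hAB hx.2⟩, hx.2⟩
    have : Countable W := hWc.to_subtype
    have hsum : m ({x | HasExpandingOrbit f S J ρ D n x} ∩ f^[n] ⁻¹' A) * m (B p) ≤
        ENNReal.ofReal (Real.exp (2 * D)) * m A * m univ := by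
      calc _ ≤ (∑' w : W, m ((w : Set M) ∩ f^[n] ⁻¹' A)) * m (B p) := by
            gcongr
            exact (measure_mono hcover).trans (measure_biUnion_le m hWc _)
        _ = ∑' w : W, m ((w : Set M) ∩ f^[n] ⁻¹' A) * m (B p) := ENNReal.tsum_mul_right.symm
        _ ≤ ∑' w : W, ENNReal.ofReal (Real.exp (2 * D)) * m A * m w := by
            refine ENNReal.tsum_le_tsum ?_
            rintro ⟨_, x, rfl⟩
            exact gm x A hAB hA
        _ = ENNReal.ofReal (Real.exp (2 * D)) * m A * ∑' w : W, m w := ENNReal.tsum_mul_left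
        _ ≤ _ := by
            gcongr
            refine (measure_biUnion (f := id) hWc hdisj ?_).symm.trans_le
              (measure_mono (subset_univ _))
            rintro _ ⟨x, rfl⟩
            exact (gop x).measurableSet
    calc _ ≤ ENNReal.ofReal (Real.exp (2 * D)) * m A * m univ / m (B p) :=
          (ENNReal.le_div_iff_mul_le (Or.inl (hBpos p)) (Or.inl (measure_ne_top _ _))).2 hsum
      _ = C p * m A := by rw [hC]; simp only [div_eq_mul_inv]; ring
  refine ⟨∑ p ∈ t, C p, ?_, fun n A ↦ ?_⟩
  · refine (ENNReal.sum_lt_top.2 fun p _ ↦ ?_).ne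
    exact ENNReal.div_lt_top (ENNReal.mul_ne_top ENNReal.ofReal_ne_top (measure_ne_top _ _))
      (hBpos p)
  -- The branch estimate needs a measurable target; a measurable hull of $A$ has the same measure.
  · rw [← measure_toMeasurable A, Finset.sum_mul]
    set A' := toMeasurable m A
    calc _ ≤ m (⋃ p ∈ t, {x | HasExpandingOrbit f S J ρ D n x} ∩ f^[n] ⁻¹' (A' ∩ B p)) := by
          refine measure_mono fun x hx ↦ ?_
          obtain ⟨p, hp, hxp⟩ := mem_iUnion₂.1 (ht (mem_univ (f^[n] x)))
          exact mem_biUnion hp ⟨hx.1, subset_toMeasurable m A hx.2, hxp⟩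
      _ ≤ ∑ p ∈ t, m ({x | HasExpandingOrbit f S J ρ D n x} ∩ f^[n] ⁻¹' (A' ∩ B p)) :=
          measure_biUnion_finset_le _ _
      _ ≤ ∑ p ∈ t, C p * m A' := by
          refine Finset.sum_le_sum fun p _ ↦ (key n p _ inter_subset_right
            ((measurableSet_toMeasurable _ _).inter (hBo p).measurableSet)).trans ?_
          gcongr
          exact inter_subset_left

end Branches

/-! ### Splitting the push-forwards by the last good time -/

section Decomposition

variable {M : Type*} [MeasurableSpace M]

/-- The points with no good time in `[1, j]`. -/
def noTimeUpTo (P : ℕ → M → Prop) (j : ℕ) : Set M := {x | ∀ k, 1 ≤ k → k ≤ j → ¬ P k x}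

/-- Let $l$ be the last good time of $x$ in $[1,n]$. By concatenation a good time of $f^l(x)$ in
$[1,n-l]$ would give a later one for $x$. The hypothesis on $C$ then bounds the part with last time
$l$, and $j=n-l$ indexes the sum. -/
theorem measure_preimage_iterate_le_sum {f : M → M} {m : Measure M} {P : ℕ → M → Prop}
    (hcat : ∀ l k x, P l x → P k (f^[l] x) → P (l + k) x) {C : ℝ≥0∞}
    (hC : ∀ n, ∀ A : Set M, m ({x | P n x} ∩ f^[n] ⁻¹' A) ≤ C * m A) (n : ℕ) (A : Set M) :
    m (f^[n] ⁻¹' A) ≤ (C + 1) * ∑ j ∈ Finset.range (n + 1), m (noTimeUpTo P j ∩ f^[j] ⁻¹' A) := by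
  classical
  have hsub : f^[n] ⁻¹' A ⊆ ⋃ l ∈ Finset.range (n + 1),
      {x | l = 0 ∨ P l x} ∩ f^[l] ⁻¹' (noTimeUpTo P (n - l) ∩ f^[n - l] ⁻¹' A) := by
    intro x hx
    -- The value is 0 when there is no good time up to $n$. That term has no density bound by $C$
    -- and accounts for the extra 1 in $C+1$.
    set l := Nat.findGreatest (fun l ↦ P l x) n with hl
    have hln : l ≤ n := Nat.findGreatest_le n
    have hl0 : l = 0 ∨ P l x := or_iff_not_imp_left.2 fun h ↦ Nat.findGreatest_of_ne_zero rfl h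
    refine mem_biUnion (x := l) (by simpa using Nat.lt_succ_of_le hln) ⟨hl0, ⟨?_, ?_⟩⟩
    · intro k hk hkn hPk
      have : P (l + k) x := by
        rcases hl0 with h | h
        · rw [h] at hPk ⊢; simpa using hPk
        · exact hcat _ _ _ h hPk
      have := Nat.le_findGreatest (P := fun l ↦ P l x) (by omega : l + k ≤ n) this
      omega
    · rw [mem_preimage, ← Function.iterate_add_apply, Nat.sub_add_cancel hln]; exact hx
  calc m (f^[n] ⁻¹' A) ≤ ∑ l ∈ Finset.range (n + 1),
        m ({x | l = 0 ∨ P l x} ∩ f^[l] ⁻¹' (noTimeUpTo P (n - l) ∩ f^[n - l] ⁻¹' A)) :=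
      (measure_mono hsub).trans (measure_biUnion_finset_le _ _)
    _ ≤ ∑ l ∈ Finset.range (n + 1),
        (C + 1) * m (noTimeUpTo P (n - l) ∩ f^[n - l] ⁻¹' A) := by
      refine Finset.sum_le_sum fun l _ ↦ ?_
      rcases l with _ | l
      · refine (measure_mono inter_subset_right).trans ?_
        exact le_mul_of_one_le_left zero_le le_add_self
      · simp only [Nat.succ_ne_zero, false_or]
        exact (hC _ _).trans (by gcongr; exact le_self_add)
    _ = _ := by
      rw [← Finset.mul_sum]
      congr 1
      exact Finset.sum_range_reflect (fun j ↦ m (noTimeUpTo P j ∩ f^[j] ⁻¹' A)) (n + 1)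

/-- The tail sum $\sum_j m(h>j)$ is finite for integrable $h\ge0$. Existence of a good time almost
everywhere is essential: a point with none has infimum 0 by default, yet belongs to every
`noTimeUpTo P j`. -/
theorem tsum_measure_noTimeUpTo_lt_top {m : Measure M} [IsProbabilityMeasure m]
    {P : ℕ → M → Prop} (hpos : ∀ n x, P n x → 1 ≤ n) (hex : ∀ᵐ x ∂m, ∃ n, P n x)
    (hint : Integrable (fun x ↦ ((sInf {n | P n x} : ℕ) : ℝ)) m) :
    ∑' j, m (noTimeUpTo P j) < ⊤ := by
  let : MeasureSpace M := ⟨m⟩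
  have : IsProbabilityMeasure (volume : Measure M) := ‹IsProbabilityMeasure m›
  refine lt_of_le_of_lt (ENNReal.tsum_le_tsum fun j ↦ ?_)
    (ProbabilityTheory.tsum_prob_mem_Ioi_lt_top (Ω := M) hint fun x ↦ Nat.cast_nonneg _)
  refine measure_mono_ae ?_
  filter_upwards [hex] with x hx hxE
  have hm : P (sInf {n | P n x}) x := Nat.sInf_mem (s := {n | P n x}) hx
  by_contra hlt
  have : sInf {n | P n x} ≤ j := by
    have h' : ¬ ((j : ℝ) < (sInf {n | P n x} : ℕ)) := hlt
    exact_mod_cast not_lt.1 h'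
  exact hxE _ (hpos _ _ hm) this hm

end Decomposition

/-! ### Weak* limits of Cesàro averages -/

section Cesaro

variable {M : Type*} [MetricSpace M] [MeasurableSpace M] [BorelSpace M]

theorem isProbabilityMeasure_cesaroAverage {f : M → M} (hf : Continuous f) (m : Measure M)
    [IsProbabilityMeasure m] {n : ℕ} (hn : n ≠ 0) : IsProbabilityMeasure (cesaroAverage f m n) := by
  refine ⟨?_⟩
  have h : ∀ j, m.map f^[j] univ = 1 := fun j ↦ by
    rw [Measure.map_apply (hf.iterate j).measurable MeasurableSet.univ, preimage_univ, measure_univ]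
  simp only [cesaroAverage, Measure.smul_apply, Measure.finsetSum_apply, h, smul_eq_mul,
    Finset.sum_const, Finset.card_range, nsmul_eq_mul, mul_one]
  exact ENNReal.inv_mul_cancel (by exact_mod_cast hn) (ENNReal.natCast_ne_top n)

variable [CompactSpace M]

theorem integral_cesaroAverage {f : M → M} (hf : Continuous f) (m : Measure M)
    [IsProbabilityMeasure m] (n : ℕ) (g : C(M, ℝ)) :
    ∫ x, g x ∂(cesaroAverage f m n) =
      (n : ℝ)⁻¹ * ∑ j ∈ Finset.range n, ∫ x, g (f^[j] x) ∂m := by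
  have hprob : ∀ j, IsProbabilityMeasure (m.map f^[j]) := fun j ↦
    Measure.isProbabilityMeasure_map (hf.iterate j).aemeasurable
  have hint : ∀ (ν : Measure M) [IsFiniteMeasure ν], Integrable g ν := fun ν _ ↦
    (BoundedContinuousFunction.mkOfCompact g).integrable ν
  rw [cesaroAverage, integral_smul_measure, integral_finsetSum_measure fun j _ ↦ hint _]
  simp only [ENNReal.toReal_inv, ENNReal.toReal_natCast, smul_eq_mul]
  congr 1
  refine Finset.sum_congr rfl fun j _ ↦ ?_
  exact integral_map (hf.iterate j).aemeasurable g.continuous.aestronglyMeasurable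

/-- The difference telescopes to $\frac1n(\int g\circ f^n\,dm-\int g\,dm)$, which is at most
$2\|g\|/n$ in absolute value. -/
theorem tendsto_integral_comp_sub_integral_cesaroAverage {f : M → M} (hf : Continuous f)
    (m : Measure M) [IsProbabilityMeasure m] (g : C(M, ℝ)) :
    Tendsto (fun n ↦ ∫ x, g (f x) ∂(cesaroAverage f m n) - ∫ x, g x ∂(cesaroAverage f m n))
      atTop (𝓝 0) := by
  have h : ∀ n, ∫ x, g (f x) ∂(cesaroAverage f m n) - ∫ x, g x ∂(cesaroAverage f m n) =
      (n : ℝ)⁻¹ * (∫ x, g (f^[n] x) ∂m - ∫ x, g x ∂m) := by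
    intro n
    have h1 := integral_cesaroAverage hf m n (g.comp ⟨f, hf⟩)
    simp only [ContinuousMap.comp_apply, ContinuousMap.coe_mk] at h1
    rw [h1, integral_cesaroAverage hf m n g, ← mul_sub, ← Finset.sum_sub_distrib]
    simp only [← Function.iterate_succ_apply' f]
    rw [Finset.sum_range_sub (fun j ↦ ∫ x, g (f^[j] x) ∂m)]
    rfl
  simp only [h]
  have hb : ∀ j, |∫ x, g (f^[j] x) ∂m| ≤ ‖g‖ := fun j ↦ by
    have := norm_integral_le_of_norm_le_const (μ := m) (f := fun x ↦ g (f^[j] x)) (C := ‖g‖)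
      (ae_of_all _ fun x ↦ g.norm_coe_le_norm _)
    simpa using this
  refine squeeze_zero_norm (a := fun n : ℕ ↦ (n : ℝ)⁻¹ * (‖g‖ + ‖g‖)) (fun n ↦ ?_) ?_
  · rw [norm_mul, Real.norm_of_nonneg (by positivity : (0 : ℝ) ≤ (n : ℝ)⁻¹)]
    gcongr
    exact (abs_sub _ _).trans (add_le_add (hb n) (hb 0))
  · simpa using tendsto_inv_atTop_nhds_zero_nat.mul_const (‖g‖ + ‖g‖)

/-- If all push-forwards of `m` are dominated by a finite measure, some subsequence of the Cesàro
averages converges to an invariant measure dominated by the same measure. -/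
theorem exists_invariant_le_of_map_iterate_le {f : M → M} (hf : Continuous f) (m : Measure M)
    [IsProbabilityMeasure m] (η : Measure M) [IsFiniteMeasure η]
    (h : ∀ n, m.map f^[n] ≤ η) :
    ∃ μ : Measure M, IsProbabilityMeasure μ ∧ MeasurePreserving f μ μ ∧ μ ≤ η ∧
      ∃ φ : ℕ → ℕ, StrictMono φ ∧ ∀ g : C(M, ℝ),
        Tendsto (fun i ↦ ∫ x, g x ∂(cesaroAverage f m (φ i))) atTop (𝓝 (∫ x, g x ∂μ)) := by
  -- The index is shifted because the average of length 0 is the zero measure.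
  let ν : ℕ → ProbabilityMeasure M := fun n ↦
    ⟨cesaroAverage f m (n + 1), isProbabilityMeasure_cesaroAverage hf m n.succ_ne_zero⟩
  obtain ⟨μ, φ, hφ, hμ⟩ := CompactSpace.tendsto_subseq ν
  have hφ' : StrictMono fun i ↦ φ i + 1 := fun i j hij ↦ Nat.succ_lt_succ (hφ hij)
  have hlim : ∀ g : C(M, ℝ), Tendsto (fun i ↦ ∫ x, g x ∂(cesaroAverage f m (φ i + 1))) atTop
      (𝓝 (∫ x, g x ∂(μ : Measure M))) := fun g ↦
    ProbabilityMeasure.tendsto_iff_forall_integral_tendsto.1 hμ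
      (BoundedContinuousFunction.mkOfCompact g)
  have hces : ∀ n A, cesaroAverage f m (n + 1) A ≤ η A := by
    intro n A
    simp only [cesaroAverage, Measure.smul_apply, Measure.finsetSum_apply, smul_eq_mul]
    calc _ ≤ ((n + 1 : ℕ) : ℝ≥0∞)⁻¹ * ∑ j ∈ Finset.range (n + 1), η A := by
          gcongr with j _
          exact h j
      _ = η A := by
          rw [Finset.sum_const, Finset.card_range, nsmul_eq_mul, ← mul_assoc,
            ENNReal.inv_mul_cancel (by simp) (ENNReal.natCast_ne_top _), one_mul]
  refine ⟨μ, inferInstance, ⟨hf.measurable, ?_⟩, ?_, fun i ↦ φ i + 1, hφ', hlim⟩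
  · have : IsProbabilityMeasure ((μ : Measure M).map f) :=
      Measure.isProbabilityMeasure_map hf.aemeasurable
    refine ext_of_forall_integral_eq_of_IsFiniteMeasure fun g ↦ ?_
    rw [integral_map hf.aemeasurable g.continuous.aestronglyMeasurable]
    have h1 := hlim (g.toContinuousMap.comp ⟨f, hf⟩)
    have h2 := hlim g.toContinuousMap
    have h3 := (tendsto_integral_comp_sub_integral_cesaroAverage hf m g.toContinuousMap).comp
      hφ'.tendsto_atTop
    exact sub_eq_zero.1 (tendsto_nhds_unique (h1.sub h2) h3)
  -- Weak* limits do not increase the measure of open sets beyond the liminf, so $\mu(U)\le\eta(U)$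
  -- for open $U$; outer regularity of $\eta$ passes this to every set.
  · refine Measure.le_iff'.2 fun A ↦ ?_
    rw [A.measure_eq_iInf_isOpen η]
    refine le_iInf₂ fun U hAU ↦ le_iInf fun hU ↦ (measure_mono hAU).trans ?_
    refine (ProbabilityMeasure.le_liminf_measure_open_of_tendsto hμ hU).trans ?_
    refine (liminf_le_liminf (v := fun _ : ℕ ↦ η U)
      (Eventually.of_forall fun i ↦ hces (φ i) U)).trans ?_
    simp

/-- The ergodic-theoretic part of the argument: good times that concatenate, have densities of
bounded images, and an integrable first good time, yield an absolutely continuous invariant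
measure. -/
theorem exists_absolutelyContinuous_invariant {f : M → M} (hf : Continuous f) (m : Measure M)
    [IsProbabilityMeasure m] (hns : ∀ Z, m Z = 0 → m (f ⁻¹' Z) = 0) {P : ℕ → M → Prop}
    (hcat : ∀ l k x, P l x → P k (f^[l] x) → P (l + k) x) (hpos : ∀ n x, P n x → 1 ≤ n)
    {C : ℝ≥0∞} (hC : C ≠ ⊤) (hCP : ∀ n, ∀ A : Set M, m ({x | P n x} ∩ f^[n] ⁻¹' A) ≤ C * m A)
    (hex : ∀ᵐ x ∂m, ∃ n, P n x)
    (hint : Integrable (fun x ↦ ((sInf {n | P n x} : ℕ) : ℝ)) m) :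
    ∃ μ : Measure M, IsProbabilityMeasure μ ∧ MeasurePreserving f μ μ ∧ μ ≪ m ∧
      ∃ φ : ℕ → ℕ, StrictMono φ ∧ ∀ g : C(M, ℝ),
        Tendsto (fun i ↦ ∫ x, g x ∂(cesaroAverage f m (φ i))) atTop (𝓝 (∫ x, g x ∂μ)) := by
  have hns' : ∀ j Z, m Z = 0 → m (f^[j] ⁻¹' Z) = 0 := by
    intro j
    induction j with
    | zero => exact fun Z hZ ↦ hZ
    | succ j ih => intro Z hZ; rw [Function.iterate_succ', preimage_comp]; exact ih _ (hns Z hZ)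
  -- This dominates every $f^n_*m$: the bound of `measure_preimage_iterate_le_sum` is a partial sum
  -- of the series.
  set η : Measure M := (C + 1) • Measure.sum fun j ↦ (m.restrict (noTimeUpTo P j)).map f^[j] with hη
  have happ : ∀ A, MeasurableSet A →
      η A = (C + 1) * ∑' j, m (noTimeUpTo P j ∩ f^[j] ⁻¹' A) := by
    intro A hA
    rw [hη, Measure.smul_apply, smul_eq_mul, Measure.sum_apply _ hA]
    congr 2
    ext j
    rw [Measure.map_apply (hf.iterate j).measurable hA,
      Measure.restrict_apply ((hf.iterate j).measurable hA), inter_comm]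
  have hfin : IsFiniteMeasure η := by
    refine ⟨?_⟩
    rw [happ _ MeasurableSet.univ]
    simp only [preimage_univ, inter_univ]
    exact ENNReal.mul_lt_top (ENNReal.add_lt_top.2 ⟨hC.lt_top, ENNReal.one_lt_top⟩)
      (tsum_measure_noTimeUpTo_lt_top hpos hex hint)
  have hηm : η ≪ m := by
    refine Measure.AbsolutelyContinuous.mk fun A hA h0 ↦ ?_
    rw [happ A hA, mul_eq_zero]
    exact Or.inr (ENNReal.tsum_eq_zero.2 fun j ↦
      measure_mono_null inter_subset_right (hns' j A h0))
  obtain ⟨μ, h1, h2, h3, h4⟩ := exists_invariant_le_of_map_iterate_le hf m η fun n ↦ by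
    refine Measure.le_iff.2 fun A hA ↦ ?_
    rw [Measure.map_apply (hf.iterate n).measurable hA, happ A hA]
    refine (measure_preimage_iterate_le_sum hcat hCP n A).trans ?_
    gcongr
    exact ENNReal.sum_le_tsum _
  exact ⟨μ, h1, h2, (Measure.absolutelyContinuous_of_le h3).trans hηm, h4⟩

end Cesaro

/-! ### From derivative bounds to Lipschitz bounds on Riemannian manifolds -/

section RiemannianLipschitz

open scoped NNReal

variable {E : Type*} [NormedAddCommGroup E] [NormedSpace ℝ E]
  {H : Type*} [TopologicalSpace H] {I : ModelWithCorners ℝ E H}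
  {X : Type*} [PseudoEMetricSpace X] [ChartedSpace H X] [IsManifold I 1 X]
  [RiemannianBundle (fun x : X ↦ TangentSpace I x)]
  {E' : Type*} [NormedAddCommGroup E'] [NormedSpace ℝ E']
  {H' : Type*} [TopologicalSpace H'] {I' : ModelWithCorners ℝ E' H'}
  {Y : Type*} [PseudoEMetricSpace Y] [ChartedSpace H' Y] [IsManifold I' 1 Y]
  [RiemannianBundle (fun y : Y ↦ TangentSpace I' y)]

-- By the chain rule the speed of $g\circ\gamma$ is at most $C$ times the speed of $\gamma$;
-- integrate.
omit [IsManifold I 1 X] [IsManifold I' 1 Y] in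
theorem pathELength_comp_le {g : X → Y} {V : Set X} (hV : IsOpen V) {C : ℝ≥0}
    (hg : ContMDiffOn I I' 1 g V) (hC : ∀ x ∈ V, ‖mfderiv I I' g x‖ₑ ≤ C) {γ : ℝ → X}
    (hγ : ContMDiffOn 𝓘(ℝ, ℝ) I 1 γ (Icc 0 1)) (hγV : ∀ t ∈ Icc (0 : ℝ) 1, γ t ∈ V) :
    pathELength I' (g ∘ γ) 0 1 ≤ C * pathELength I γ 0 1 := by
  rw [pathELength_eq_lintegral_mfderivWithin_Icc, pathELength_eq_lintegral_mfderivWithin_Icc,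
    ← lintegral_const_mul' _ _ ENNReal.coe_ne_top]
  refine setLIntegral_mono' measurableSet_Icc fun t ht ↦ ?_
  have h1 : mfderivWithin 𝓘(ℝ, ℝ) I' (g ∘ γ) (Icc 0 1) t =
      (mfderiv I I' g (γ t)) ∘L (mfderivWithin 𝓘(ℝ, ℝ) I γ (Icc 0 1) t) := by
    apply mfderiv_comp_mfderivWithin
    · exact (hg.mdifferentiableOn one_ne_zero).mdifferentiableAt (hV.mem_nhds (hγV t ht))
    · exact hγ.mdifferentiableOn one_ne_zero t ht
    · rw [uniqueMDiffWithinAt_iff_uniqueDiffWithinAt]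
      exact uniqueDiffOn_Icc zero_lt_one t ht
  have h2 : mfderivWithin 𝓘(ℝ, ℝ) I' (g ∘ γ) (Icc 0 1) t 1 =
      (mfderiv I I' g (γ t)) (mfderivWithin 𝓘(ℝ, ℝ) I γ (Icc 0 1) t 1) := congr($h1 1)
  rw [h2]
  refine (ContinuousLinearMap.le_opENorm _ _).trans ?_
  gcongr
  exact hC _ (hγV t ht)

omit [IsManifold I 1 X] [IsManifold I' 1 Y] in
/-- A `C^1` map with derivative bounded by `C` on a ball is `C`-Lipschitz on a smaller ball. -/
theorem edist_le_of_enorm_mfderiv_le [IsRiemannianManifold I X] [IsRiemannianManifold I' Y]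
    {g : X → Y} {p : X} {r : ℝ≥0∞} {C : ℝ≥0}
    (hg : ContMDiffOn I I' 1 g (Metric.eball p (3 * r)))
    (hC : ∀ x ∈ Metric.eball p (3 * r), ‖mfderiv I I' g x‖ₑ ≤ C) {u v : X}
    (hu : u ∈ Metric.eball p r) (hv : v ∈ Metric.eball p r) :
    edist (g u) (g v) ≤ C * edist u v := by
  have huv : edist u v < 2 * r := by
    refine (edist_triangle_right u v p).trans_lt ?_
    rw [two_mul]
    exact ENNReal.add_lt_add hu hv
  -- A path from $u$ of length below $2r$ stays in the ball of radius $3r$, which is why the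
  -- derivative bound is assumed there. Afterwards $L$ decreases to the distance of $u$ and $v$.
  have key : ∀ L, edist u v < L → L ≤ 2 * r → edist (g u) (g v) ≤ C * L := by
    intro L hL hLr
    rw [IsRiemannianManifold.out (I := I) u v] at hL
    obtain ⟨γ, h0, h1, hγ, hlen⟩ := exists_lt_of_riemannianEDist_lt hL
    have hmem : ∀ t ∈ Icc (0 : ℝ) 1, γ t ∈ Metric.eball p (3 * r) := by
      intro t ht
      have hd : edist (γ t) u < 2 * r := by
        rw [edist_comm, IsRiemannianManifold.out (I := I)]
        refine (riemannianEDist_le_pathELength (hγ.mono (Icc_subset_Icc_right ht.2))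
          h0 rfl ht.1).trans_lt ?_
        exact (pathELength_mono le_rfl ht.2).trans_lt (hlen.trans_le hLr)
      refine (edist_triangle (γ t) u p).trans_lt ((ENNReal.add_lt_add hd hu).trans_eq ?_)
      ring
    rw [IsRiemannianManifold.out (I := I')]
    refine (riemannianEDist_le_pathELength (γ := g ∘ γ) (hg.comp hγ hmem) (by simp [h0])
      (by simp [h1]) zero_le_one).trans ?_
    refine (pathELength_comp_le Metric.isOpen_eball hg hC hγ hmem).trans ?_
    gcongr
  have hne : (𝓝[>] edist u v).NeBot := nhdsGT_neBot_of_exists_gt ⟨_, huv⟩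
  have hlim : Tendsto (fun L ↦ (C : ℝ≥0∞) * L) (𝓝[>] edist u v) (𝓝 (C * edist u v)) :=
    (ENNReal.Tendsto.const_mul tendsto_id (Or.inr ENNReal.coe_ne_top)).mono_left
      nhdsWithin_le_nhds
  refine ge_of_tendsto hlim ?_
  filter_upwards [Ioo_mem_nhdsGT huv] with L hL
  exact key L hL.1 hL.2.le

/-- The norm of the derivative of a `C^1` map between Riemannian manifolds is continuous. -/
theorem ContMDiffAt.continuousAt_norm_mfderiv
    [IsContinuousRiemannianBundle E (fun x : X ↦ TangentSpace I x)]
    [IsContinuousRiemannianBundle E' (fun y : Y ↦ TangentSpace I' y)]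
    {g : X → Y} {p : X} (hg : ContMDiffAt I I' 1 g p) :
    ContinuousAt (fun x ↦ ‖mfderiv I I' g x‖) p := by
  set τ := trivializationAt E (fun x : X ↦ TangentSpace I x) p
  set τ' := trivializationAt E' (fun y : Y ↦ TangentSpace I' y) (g p)
  -- The norm on the tangent space varies with the point, so the derivative at $x$ is transported by
  -- trivializations to the fixed fibres at $p$ and $g(p)$, where continuity of its coordinates
  -- suffices.
  let A : X → (TangentSpace I p →L[ℝ] TangentSpace I' (g p)) := fun x ↦
    (τ'.symmL ℝ (g p)) ∘L (inTangentCoordinates I I' id g (mfderiv I I' g) p x) ∘L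
      (τ.continuousLinearMapAt ℝ p)
  have hcoord : ContinuousAt (inTangentCoordinates I I' id g (mfderiv I I' g) p) p :=
    (hg.mfderiv_const (m := 0) (by simp)).continuousAt
  have hA : ContinuousAt (fun x ↦ ‖A x‖) p := by
    set T : X → (E →L[ℝ] E') := inTangentCoordinates I I' id g (mfderiv I I' g) p
    have h1 : ∀ x, ‖A x - A p‖ ≤
        ‖τ'.symmL ℝ (g p)‖ * (‖T x - T p‖ * ‖τ.continuousLinearMapAt ℝ p‖) := by
      intro x
      have : A x - A p = (τ'.symmL ℝ (g p)) ∘L (T x - T p) ∘L (τ.continuousLinearMapAt ℝ p) := by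
        ext v
        simp only [A, sub_apply, ContinuousLinearMap.comp_apply, map_sub]
        rfl
      rw [this]
      exact (ContinuousLinearMap.opNorm_comp_le _ _).trans
        (mul_le_mul_of_nonneg_left (ContinuousLinearMap.opNorm_comp_le _ _) (norm_nonneg _))
    have h2 : Tendsto (fun x ↦ ‖T x - T p‖) (𝓝 p) (𝓝 0) :=
      tendsto_iff_norm_sub_tendsto_zero.1 hcoord
    have h3 := (h2.mul_const ‖τ.continuousLinearMapAt ℝ p‖).const_mul ‖τ'.symmL ℝ (g p)‖
    rw [zero_mul, mul_zero] at h3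
    rw [ContinuousAt, tendsto_iff_norm_sub_tendsto_zero]
    exact squeeze_zero (fun _ ↦ norm_nonneg _)
      (fun x ↦ (abs_norm_sub_norm_le (A x) (A p)).trans (h1 x)) h3
  let P : ∀ x, TangentSpace I p →L[ℝ] TangentSpace I x := fun x ↦
    (τ.symmL ℝ x) ∘L (τ.continuousLinearMapAt ℝ p)
  let Q : ∀ x, TangentSpace I x →L[ℝ] TangentSpace I p := fun x ↦
    (τ.symmL ℝ p) ∘L (τ.continuousLinearMapAt ℝ x)
  let P' : ∀ y, TangentSpace I' (g p) →L[ℝ] TangentSpace I' y := fun y ↦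
    (τ'.symmL ℝ y) ∘L (τ'.continuousLinearMapAt ℝ (g p))
  let Q' : ∀ y, TangentSpace I' y →L[ℝ] TangentSpace I' (g p) := fun y ↦
    (τ'.symmL ℝ (g p)) ∘L (τ'.continuousLinearMapAt ℝ y)
  have hAx : ∀ x, A x = Q' (g x) ∘L mfderiv I I' g x ∘L P x := fun x ↦ rfl
  have hp : p ∈ τ.baseSet := FiberBundle.mem_baseSet_trivializationAt' p
  have hp' : g p ∈ τ'.baseSet := FiberBundle.mem_baseSet_trivializationAt' (g p)
  have hDx : ∀ x ∈ τ.baseSet, g x ∈ τ'.baseSet →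
      mfderiv I I' g x = P' (g x) ∘L A x ∘L Q x := by
    intro x hx hgx
    ext v
    simp only [hAx, P, Q, P', Q', ContinuousLinearMap.comp_apply]
    rw [τ.continuousLinearMapAt_symmL hp, τ.symmL_continuousLinearMapAt hx,
      τ'.continuousLinearMapAt_symmL hp', τ'.symmL_continuousLinearMapAt hgx]
  -- For any $r>1$ the transports have norm at most $r$ near $p$, so the two norms agree up to the
  -- factor $r^2$; finally $r\to1$.
  have key : ∀ r : ℝ, 1 < r → ∀ᶠ x in 𝓝 p, ‖A x‖ ≤ r ^ 2 * ‖mfderiv I I' g x‖ ∧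
      ‖mfderiv I I' g x‖ ≤ r ^ 2 * ‖A x‖ := by
    intro r hr
    have hr0 : 0 ≤ r := by linarith
    have b1 := eventually_norm_symmL_trivializationAt_comp_self_lt E
      (fun x : X ↦ TangentSpace I x) p hr
    have b2 := eventually_norm_symmL_trivializationAt_self_comp_lt E
      (fun x : X ↦ TangentSpace I x) p hr
    have b3 := hg.continuousAt.eventually (eventually_norm_symmL_trivializationAt_comp_self_lt E'
      (fun y : Y ↦ TangentSpace I' y) (g p) hr)
    have b4 := hg.continuousAt.eventually (eventually_norm_symmL_trivializationAt_self_comp_lt E'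
      (fun y : Y ↦ TangentSpace I' y) (g p) hr)
    filter_upwards [b1, b2, b3, b4, τ.open_baseSet.mem_nhds hp,
      hg.continuousAt.preimage_mem_nhds (τ'.open_baseSet.mem_nhds hp')]
      with x h1 h2 h3 h4 h5 h6
    have h1' : ‖P x‖ ≤ r := h1.le
    have h2' : ‖Q x‖ ≤ r := h2.le
    have h3' : ‖P' (g x)‖ ≤ r := h3.le
    have h4' : ‖Q' (g x)‖ ≤ r := h4.le
    constructor
    · rw [hAx]
      calc _ ≤ ‖Q' (g x)‖ * (‖mfderiv I I' g x‖ * ‖P x‖) :=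
            (ContinuousLinearMap.opNorm_comp_le _ _).trans
              (mul_le_mul_of_nonneg_left (ContinuousLinearMap.opNorm_comp_le _ _) (norm_nonneg _))
        _ ≤ r * (‖mfderiv I I' g x‖ * r) := by gcongr
        _ = _ := by ring
    · calc _ = ‖P' (g x) ∘L A x ∘L Q x‖ := by rw [← hDx x h5 h6]
        _ ≤ ‖P' (g x)‖ * (‖A x‖ * ‖Q x‖) :=
            (ContinuousLinearMap.opNorm_comp_le _ _).trans
              (mul_le_mul_of_nonneg_left (ContinuousLinearMap.opNorm_comp_le _ _) (norm_nonneg _))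
        _ ≤ r * (‖A x‖ * r) := by gcongr
        _ = _ := by ring
  have hAp : ‖A p‖ = ‖mfderiv I I' g p‖ := by
    congr 1
    rw [hDx p hp hp']
    ext v
    simp only [P', Q, ContinuousLinearMap.comp_apply]
    rw [τ.symmL_continuousLinearMapAt hp, τ'.symmL_continuousLinearMapAt hp']
  have hsq : Tendsto (fun r : ℝ ↦ r ^ 2) (𝓝[>] 1) (𝓝 1) := by
    have : Tendsto (fun r : ℝ ↦ r ^ 2) (𝓝 1) (𝓝 (1 ^ 2)) := (continuous_pow 2).tendsto 1
    rw [one_pow] at this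
    exact this.mono_left nhdsWithin_le_nhds
  rw [ContinuousAt, ← hAp, tendsto_order]
  constructor
  · intro a ha
    have h1 : ∀ᶠ r in 𝓝[>] (1 : ℝ), r ^ 2 * a < ‖A p‖ := by
      have := hsq.mul_const a
      rw [one_mul] at this
      exact this.eventually_lt_const ha
    obtain ⟨r, hr, hr1⟩ := (h1.and self_mem_nhdsWithin).exists
    have hr0 : 0 < r ^ 2 := pow_pos (zero_lt_one.trans hr1) 2
    filter_upwards [key r hr1, hA.eventually_const_lt hr] with x hx hx'
    exact lt_of_mul_lt_mul_left (hx'.trans_le hx.1) hr0.le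
  · intro a ha
    have h1 : ∀ᶠ r in 𝓝[>] (1 : ℝ), r ^ 2 * ‖A p‖ < a := by
      have := hsq.mul_const ‖A p‖
      rw [one_mul] at this
      exact this.eventually_lt_const ha
    obtain ⟨r, hr, hr1⟩ := (h1.and self_mem_nhdsWithin).exists
    have h2 : ContinuousAt (fun x ↦ r ^ 2 * ‖A x‖) p := hA.const_mul _
    filter_upwards [key r hr1, h2.eventually_lt_const hr] with x hx hx'
    exact hx.2.trans_lt hx'

/-- A `C^1` map is Lipschitz near a point, with any constant larger than the norm of the
derivative. -/
theorem ContMDiffAt.exists_lipschitzOnWith_of_norm_mfderiv_lt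
    [IsContinuousRiemannianBundle E (fun x : X ↦ TangentSpace I x)]
    [IsContinuousRiemannianBundle E' (fun y : Y ↦ TangentSpace I' y)]
    [IsRiemannianManifold I X] [IsRiemannianManifold I' Y]
    {g : X → Y} {p : X} (hg : ContMDiffAt I I' 1 g p) {C : ℝ≥0} (hC : ‖mfderiv I I' g p‖ < C) :
    ∃ U ∈ 𝓝 p, LipschitzOnWith C g U := by
  have h1 := ((contMDiffAt_iff_contMDiffAt_nhds (by simp)).1 hg).and (hg.continuousAt_norm_mfderiv.eventually_lt_const hC)
  obtain ⟨ε, hε, hsub⟩ := EMetric.mem_nhds_iff.1 h1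
  have h3 : 3 * (ε / 3) = ε := ENNReal.mul_div_cancel (by simp) (by simp)
  refine ⟨Metric.eball p (ε / 3), Metric.eball_mem_nhds _ (ENNReal.div_pos hε.ne' (by simp)),
    fun u hu v hv ↦ edist_le_of_enorm_mfderiv_le (I := I) (I' := I') (r := ε / 3) ?_ ?_ hu hv⟩
  · rw [h3]
    exact fun x hx ↦ (hsub hx).1.contMDiffWithinAt
  · rw [h3]
    intro x hx
    rw [← ofReal_norm, ← ENNReal.ofReal_coe_nnreal]
    exact ENNReal.ofReal_le_ofReal (hsub hx).2.le

theorem ContMDiffAt.exists_lipschitzOnWith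
    [IsContinuousRiemannianBundle E (fun x : X ↦ TangentSpace I x)]
    [IsContinuousRiemannianBundle E' (fun y : Y ↦ TangentSpace I' y)]
    [IsRiemannianManifold I X] [IsRiemannianManifold I' Y]
    {g : X → Y} {p : X} (hg : ContMDiffAt I I' 1 g p) :
    ∃ C : ℝ≥0, ∃ U ∈ 𝓝 p, LipschitzOnWith C g U :=
  ⟨‖mfderiv I I' g p‖₊ + 1, hg.exists_lipschitzOnWith_of_norm_mfderiv_lt (by simp)⟩

end RiemannianLipschitz

/-! ### Local inverses, charts and short contractions -/

section RiemannianCharts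

open scoped NNReal

theorem isContinuousRiemannianBundle_vectorSpace {F : Type*} [NormedAddCommGroup F]
    [InnerProductSpace ℝ F] :
    IsContinuousRiemannianBundle F (fun x : F ↦ TangentSpace 𝓘(ℝ, F) x) :=
  ⟨⟨(riemannianMetricVectorSpace F).inner, (riemannianMetricVectorSpace F).contMDiff.continuous,
    fun _ _ _ ↦ rfl⟩⟩

variable {d : ℕ} {M : Type*} [MetricSpace M] [ChartedSpace (EuclideanSpace ℝ (Fin d)) M]
  [RiemannianBundle (fun x : M ↦ TangentSpace (𝓡 d) x)]

theorem isContinuousRiemannianBundle_of_isContMDiff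
    [IsManifold (𝓡 d) 1 M] [h : IsContMDiffRiemannianBundle (𝓡 d) ∞ (EuclideanSpace ℝ (Fin d))
      (fun x : M ↦ TangentSpace (𝓡 d) x)] :
    IsContinuousRiemannianBundle (EuclideanSpace ℝ (Fin d))
      (fun x : M ↦ TangentSpace (𝓡 d) x) := by
  obtain ⟨g, hg, hg'⟩ := h.exists_contMDiff
  exact ⟨g, hg.continuous, hg'⟩

-- As the derivative of an honest $C^2$ map, `derivInv` falls under the general results on norms of
-- derivatives and Lipschitz constants.
omit [RiemannianBundle (fun x : M ↦ TangentSpace (𝓡 d) x)] in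
theorem derivInv_eq_mfderiv_localInverse {f : M → M} {x y : M}
    (hf : IsLocalDiffeomorphAt (𝓡 d) (𝓡 d) 2 f x) (hy : y ∈ hf.localInverse.target) :
    derivInv f y = mfderiv (𝓡 d) (𝓡 d) hf.localInverse (f y) := by
  have hg : hf.localInverse (f y) = y := hf.localInverse_left_inv hy
  have hys : f y ∈ hf.localInverse.source := by
    have : f y = hf.localInverse.symm y := hf.choose_spec.2 hy
    rw [this]
    exact hf.localInverse.symm.map_source hy
  have hfy : MDifferentiableAt (𝓡 d) (𝓡 d) f y :=
    ((hf.choose.contMDiffOn.congr hf.choose_spec.2).contMDiffAt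
      (hf.choose.open_source.mem_nhds hy)).mdifferentiableAt two_ne_zero
  have hgy : MDifferentiableAt (𝓡 d) (𝓡 d) hf.localInverse (f y) :=
    hf.localInverse.mdifferentiableAt two_ne_zero hys
  have e1 : hf.localInverse ∘ f =ᶠ[𝓝 y] id :=
    hf.localInverse_eqOn_left.eventuallyEq_of_mem (hf.localInverse.open_target.mem_nhds hy)
  have e2 : f ∘ hf.localInverse =ᶠ[𝓝 (f y)] id :=
    hf.localInverse_eqOn_right.eventuallyEq_of_mem (hf.localInverse.open_source.mem_nhds hys)
  refine ContinuousLinearMap.inverse_eq ?_ ?_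
  · rw [← mfderiv_id, ← e2.mfderiv_eq, mfderiv_comp _ (by rw [hg]; exact hfy) hgy, hg]
  · rw [← mfderiv_id, ← e1.mfderiv_eq]
    exact (mfderiv_comp _ hgy hfy).symm

theorem norm_derivInv_eq {f : M → M} {x y : M}
    (hf : IsLocalDiffeomorphAt (𝓡 d) (𝓡 d) 2 f x) (hy : y ∈ hf.localInverse.target) :
    ‖derivInv (d := d) f y‖ = ‖mfderiv (𝓡 d) (𝓡 d) hf.localInverse (f y)‖ := by
  -- The local inverse maps $f(y)$ to $y$ only up to a propositional equality, so the codomains, and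
  -- with them the norms, are identified by substitution.
  have h : ∀ z, z = y → ∀ A : TangentSpace (𝓡 d) (f y) →L[ℝ] TangentSpace (𝓡 d) z,
      derivInv f y = A → ‖derivInv (d := d) f y‖ = ‖A‖ := by
    rintro _ rfl A h
    rw [h]
  exact h _ (hf.localInverse_left_inv hy) _ (derivInv_eq_mfderiv_localInverse hf hy)

variable [IsManifold (𝓡 d) ∞ M]
  [IsContMDiffRiemannianBundle (𝓡 d) ∞ (EuclideanSpace ℝ (Fin d))
    (fun x : M ↦ TangentSpace (𝓡 d) x)]
  [IsRiemannianManifold (𝓡 d) M]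

/-- A local diffeomorphism expands distances locally by any factor below `‖Df(y)⁻¹‖⁻¹`. -/
theorem isLocallyExpandingAt_of_norm_derivInv_lt {f : M → M} {y : M}
    (hf : IsLocalDiffeomorphAt (𝓡 d) (𝓡 d) 2 f y) {κ : ℝ} (hκ : ‖derivInv (d := d) f y‖ < κ) :
    IsLocallyExpandingAt f κ y := by
  have := isContinuousRiemannianBundle_of_isContMDiff (d := d) (M := M)
  rw [norm_derivInv_eq hf hf.localInverse_mem_target] at hκ
  have hκ0 : 0 ≤ κ := (norm_nonneg (mfderiv (𝓡 d) (𝓡 d) hf.localInverse (f y))).trans hκ.le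
  lift κ to ℝ≥0 using hκ0
  obtain ⟨U, hU, hL⟩ := (hf.localInverse_contMDiffAt.of_le
    one_le_two).exists_lipschitzOnWith_of_norm_mfderiv_lt hκ
  refine ⟨f ⁻¹' U ∩ hf.localInverse.target, inter_mem
    (hf.contMDiffAt.continuousAt.preimage_mem_nhds hU)
    (hf.localInverse.open_target.mem_nhds hf.localInverse_mem_target), fun u hu v hv ↦ ?_⟩
  have := hL.dist_le_mul _ hu.1 _ hv.1
  rwa [hf.localInverse_left_inv hu.2, hf.localInverse_left_inv hv.2] at this

omit [IsRiemannianManifold (𝓡 d) M] in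
/-- The norm `‖Df(x)⁻¹‖` depends continuously on `x` where `f` is a local diffeomorphism. -/
theorem continuousAt_norm_derivInv {f : M → M} {x : M}
    (hf : IsLocalDiffeomorphAt (𝓡 d) (𝓡 d) 2 f x) :
    ContinuousAt (fun y ↦ ‖derivInv (d := d) f y‖) x := by
  have := isContinuousRiemannianBundle_of_isContMDiff (d := d) (M := M)
  have h1 := (hf.localInverse_contMDiffAt.of_le one_le_two).continuousAt_norm_mfderiv
  have h2 := ContinuousAt.comp (f := f) h1 hf.contMDiffAt.continuousAt
  refine h2.congr ?_
  filter_upwards [hf.localInverse.open_target.mem_nhds hf.localInverse_mem_target] with y hy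
  exact (norm_derivInv_eq hf hy).symm

variable (d) in
theorem exists_lipschitzOnWith_extChartAt (p : M) :
    ∃ C : ℝ≥0, ∃ U ∈ 𝓝 p, LipschitzOnWith C (extChartAt (𝓡 d) p) U := by
  have := isContinuousRiemannianBundle_of_isContMDiff (d := d) (M := M)
  have := isContinuousRiemannianBundle_vectorSpace (F := EuclideanSpace ℝ (Fin d))
  exact (contMDiffAt_extChartAt (I := 𝓡 d) (n := 1) (x := p)).exists_lipschitzOnWith

variable (d) in
theorem exists_lipschitzOnWith_extChartAt_symm (p : M) :
    ∃ C : ℝ≥0, ∃ U ∈ 𝓝 (extChartAt (𝓡 d) p p),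
      LipschitzOnWith C (extChartAt (𝓡 d) p).symm U := by
  have := isContinuousRiemannianBundle_of_isContMDiff (d := d) (M := M)
  have := isContinuousRiemannianBundle_vectorSpace (F := EuclideanSpace ℝ (Fin d))
  have h : ContMDiffAt 𝓘(ℝ, EuclideanSpace ℝ (Fin d)) (𝓡 d) 1 (extChartAt (𝓡 d) p).symm
      (extChartAt (𝓡 d) p p) :=
    (contMDiffOn_extChartAt_symm p).contMDiffAt (extChartAt_target_mem_nhds p)
  exact h.exists_lipschitzOnWith

/-- Every point has a neighborhood that is contractible along short paths. -/
theorem exists_isShortlyContractible (d : ℕ) {M : Type*} [MetricSpace M]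
    [ChartedSpace (EuclideanSpace ℝ (Fin d)) M] [IsManifold (𝓡 d) ∞ M]
    [RiemannianBundle (fun x : M ↦ TangentSpace (𝓡 d) x)]
    [IsContMDiffRiemannianBundle (𝓡 d) ∞ (EuclideanSpace ℝ (Fin d))
      (fun x : M ↦ TangentSpace (𝓡 d) x)] [IsRiemannianManifold (𝓡 d) M] (p : M) {ρ : ℝ} (hρ : 0 < ρ) :
    ∃ B : Set M, IsOpen B ∧ p ∈ B ∧ IsPreconnected B ∧ IsShortlyContractible ρ B := by
  obtain ⟨C, U, hU, hC⟩ := exists_lipschitzOnWith_extChartAt_symm d p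
  set φ := extChartAt (𝓡 d) p with hφ
  obtain ⟨r₀, hr₀, hr₀U⟩ := Metric.mem_nhds_iff.1 (inter_mem hU (extChartAt_target_mem_nhds p))
  -- The contraction follows straight segments in a coordinate ball of radius $r$. These have length
  -- at most $2r$ there, hence at most $2Cr$ in $M$.
  obtain ⟨r, hr, hrr, hrC⟩ : ∃ r > 0, r ≤ r₀ ∧ C * (2 * r) ≤ ρ := by
    refine ⟨min r₀ (ρ / (2 * (C + 1))), by positivity, min_le_left _ _, ?_⟩
    have h1 : min r₀ (ρ / (2 * (C + 1))) ≤ ρ / (2 * (C + 1)) := min_le_right _ _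
    have h2 : (C : ℝ) * (2 * (ρ / (2 * (C + 1)))) ≤ ρ := by
      have : (C : ℝ) * (2 * (ρ / (2 * (C + 1)))) = C / (C + 1) * ρ := by field_simp
      rw [this]
      exact mul_le_of_le_one_left hρ.le ((div_le_one (by positivity)).2 (by linarith))
    refine le_trans ?_ h2
    gcongr
  set V := Metric.ball (φ p) r with hV
  have hVU : V ⊆ U ∩ φ.target := (Metric.ball_subset_ball hrr).trans hr₀U
  have hB : φ.symm '' V = φ.source ∩ φ ⁻¹' V :=
    φ.symm_image_eq_source_inter_preimage (fun v hv ↦ (hVU hv).2)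
  have hcont : ContinuousOn φ.symm V :=
    (continuousOn_extChartAt_symm p).mono fun v hv ↦ (hVU hv).2
  refine ⟨φ.symm '' V, ?_, ?_, ?_, ?_⟩
  · rw [hB]
    exact (continuousOn_extChartAt p).isOpen_inter_preimage (isOpen_extChartAt_source p)
      Metric.isOpen_ball
  · exact ⟨φ p, Metric.mem_ball_self hr, extChartAt_to_inv p⟩
  · exact (convex_ball _ _).isPreconnected.image _ hcont
  · intro u hu
    rw [hB] at hu
    have hmem : ∀ v : φ.symm '' V, (v : M) ∈ φ.source ∩ φ ⁻¹' V := fun v ↦ hB ▸ v.2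
    have hseg : ∀ q : unitInterval × (φ.symm '' V),
        AffineMap.lineMap (φ u) (φ q.2) (q.1 : ℝ) ∈ V := fun q ↦
      (convex_ball _ _).lineMap_mem hu.2 (hmem q.2).2 q.1.2
    have hcl : Continuous fun q : unitInterval × (φ.symm '' V) ↦
        AffineMap.lineMap (φ u) (φ q.2) (q.1 : ℝ) := by
      have h1 : Continuous fun v : φ.symm '' V ↦ φ v :=
        (continuousOn_extChartAt p).comp_continuous continuous_subtype_val fun v ↦ (hmem v).1
      have h2 : Continuous fun q : unitInterval × (φ.symm '' V) ↦ φ q.2 := h1.comp continuous_snd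
      have h3 : Continuous fun q : unitInterval × (φ.symm '' V) ↦ (q.1 : ℝ) :=
        continuous_subtype_val.comp continuous_fst
      exact continuous_const.lineMap h2 h3
    refine ⟨⟨fun q ↦ φ.symm (AffineMap.lineMap (φ u) (φ q.2) (q.1 : ℝ)),
      hcont.comp_continuous hcl hseg⟩, fun v ↦ ?_, fun v ↦ ?_, fun v hv t ↦ ?_, fun v s t ↦ ?_⟩
    · simp [φ.left_inv hu.1]
    · simp [φ.left_inv (hmem v).1]
    · simp [hv, φ.left_inv hu.1]
    · refine (hC.dist_le_mul _ (hVU (hseg (s, v))).1 _ (hVU (hseg (t, v))).1).trans ?_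
      simp only [dist_lineMap_lineMap, Real.dist_eq]
      rw [mul_comm (|(s : ℝ) - t|), ← mul_assoc]
      gcongr
      refine le_trans ?_ hrC
      gcongr
      have h1 : dist (φ u) (φ p) < r := hu.2
      have h2 : dist (φ v) (φ p) < r := (hmem v).2
      linarith [dist_triangle_right (φ u) (φ v) (φ p)]

end RiemannianCharts

/-! ### Gram determinants and the determinant of the derivative -/

section GramDeterminant

theorem det_gram_eq_of_eq_sum {V : Type*} [NormedAddCommGroup V] [InnerProductSpace ℝ V] {d : ℕ}
    {v w : Fin d → V} (A : Matrix (Fin d) (Fin d) ℝ) (h : ∀ i, w i = ∑ j, A j i • v j) :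
    (Matrix.gram ℝ w).det = A.det ^ 2 * (Matrix.gram ℝ v).det := by
  have : Matrix.gram ℝ w = A.transpose * Matrix.gram ℝ v * A := by
    ext i k
    simp only [Matrix.gram_apply, h, Matrix.mul_apply, Matrix.transpose_apply, sum_inner,
      inner_sum, inner_smul_left, inner_smul_right, Finset.sum_mul, Finset.mul_sum, conj_trivial]
    refine Finset.sum_congr rfl fun j _ ↦ Finset.sum_congr rfl fun l _ ↦ ?_
    ring
  rw [this, Matrix.det_mul, Matrix.det_mul, Matrix.det_transpose]
  ring

variable {d : ℕ} {M : Type*} [MetricSpace M] [ChartedSpace (EuclideanSpace ℝ (Fin d)) M]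
  [RiemannianBundle (fun x : M ↦ TangentSpace (𝓡 d) x)]

/-- A continuous linear map between tangent spaces, as an endomorphism of the model space. -/
def modelMap {x y : M} (L : TangentSpace (𝓡 d) x →L[ℝ] TangentSpace (𝓡 d) y) :
    EuclideanSpace ℝ (Fin d) →L[ℝ] EuclideanSpace ℝ (Fin d) := L

/-- The image of the `i`-th standard basis vector under `T`, as a tangent vector at `x`. -/
def frameVec (x : M) (T : EuclideanSpace ℝ (Fin d) →L[ℝ] EuclideanSpace ℝ (Fin d)) (i : Fin d) :
    TangentSpace (𝓡 d) x := T (EuclideanSpace.single i (1 : ℝ))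

/-- The volume of the parallelepiped spanned in the tangent space at `x` by the images of the
standard basis under a linear map. -/
def frameVolume (x : M) (T : EuclideanSpace ℝ (Fin d) →L[ℝ] EuclideanSpace ℝ (Fin d)) : ℝ :=
  √(Matrix.gram ℝ (frameVec x T)).det

/-- A change of frame multiplies the Gram determinant by the square of its determinant.
Multiplicativity of `absDet`, its behavior under inversion and the change of chart densities all
reduce to this. -/
theorem frameVolume_comp (x : M) (T B : EuclideanSpace ℝ (Fin d) →L[ℝ] EuclideanSpace ℝ (Fin d)) :
    frameVolume x (T ∘L B) = |B.det| * frameVolume x T := by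
  let T' : EuclideanSpace ℝ (Fin d) →ₗ[ℝ] TangentSpace (𝓡 d) x := T.toLinearMap
  let b := (EuclideanSpace.basisFun (Fin d) ℝ).toBasis
  have h := det_gram_eq_of_eq_sum (v := frameVec x T) (w := frameVec x (T ∘L B))
    (LinearMap.toMatrix b b B) (by
      intro i
      have h1 : B (EuclideanSpace.single i (1 : ℝ)) =
          ∑ j, LinearMap.toMatrix b b B j i • EuclideanSpace.single j (1 : ℝ) := by
        have := (b.sum_repr (B (EuclideanSpace.single i (1 : ℝ)))).symm
        simpa [b, LinearMap.toMatrix_apply] using this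
      change T' (B (EuclideanSpace.single i (1 : ℝ))) = _
      rw [h1, map_sum]
      simp only [map_smul]
      rfl)
  rw [LinearMap.det_toMatrix] at h
  rw [frameVolume, h, Real.sqrt_mul (sq_nonneg _), Real.sqrt_sq_eq_abs]
  rfl

theorem frameVolume_id_pos (x : M) :
    0 < frameVolume x (ContinuousLinearMap.id ℝ (EuclideanSpace ℝ (Fin d))) := by
  apply Real.sqrt_pos.2
  apply Matrix.PosDef.det_pos
  apply Matrix.posDef_gram_of_linearIndependent
  let T' : EuclideanSpace ℝ (Fin d) →ₗ[ℝ] TangentSpace (𝓡 d) x :=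
    (LinearMap.id : EuclideanSpace ℝ (Fin d) →ₗ[ℝ] EuclideanSpace ℝ (Fin d))
  have := (EuclideanSpace.basisFun (Fin d) ℝ).toBasis.linearIndependent.map' T'
    (LinearMap.ker_eq_bot.2 fun _ _ h ↦ h)
  have h2 : frameVec x (ContinuousLinearMap.id ℝ (EuclideanSpace ℝ (Fin d))) =
      T' ∘ (EuclideanSpace.basisFun (Fin d) ℝ).toBasis := by
    funext i
    simp only [Function.comp_apply, OrthonormalBasis.coe_toBasis, EuclideanSpace.basisFun_apply]
    rfl
  rw [h2]
  exact this

theorem absDet_eq {x y : M} (L : TangentSpace (𝓡 d) x →L[ℝ] TangentSpace (𝓡 d) y) :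
    absDet L = frameVolume y (modelMap L) /
      frameVolume x (ContinuousLinearMap.id ℝ (EuclideanSpace ℝ (Fin d))) :=
  rfl

theorem absDet_mul_frameVolume {x y : M} (L : TangentSpace (𝓡 d) x →L[ℝ] TangentSpace (𝓡 d) y)
    (B : EuclideanSpace ℝ (Fin d) →L[ℝ] EuclideanSpace ℝ (Fin d)) :
    absDet L * frameVolume x B = frameVolume y (modelMap L ∘L B) := by
  have h := frameVolume_comp x (ContinuousLinearMap.id ℝ _) B
  rw [ContinuousLinearMap.id_comp] at h
  have h0 := (frameVolume_id_pos (d := d) x).ne'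
  rw [frameVolume_comp, h, absDet_eq]
  field_simp

theorem frameVolume_pos {x : M} {T : EuclideanSpace ℝ (Fin d) →L[ℝ] EuclideanSpace ℝ (Fin d)}
    (hT : T.IsInvertible) : 0 < frameVolume x T := by
  have h := frameVolume_comp x (ContinuousLinearMap.id ℝ _) T
  rw [ContinuousLinearMap.id_comp] at h
  rw [h]
  obtain ⟨e, rfl⟩ := hT
  exact mul_pos (abs_pos.2 (LinearEquiv.isUnit_det' e.toLinearEquiv).ne_zero) (frameVolume_id_pos x)

theorem absDet_pos {x y : M} {L : TangentSpace (𝓡 d) x →L[ℝ] TangentSpace (𝓡 d) y}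
    (hL : L.IsInvertible) : 0 < absDet L := by
  rw [absDet_eq]
  exact div_pos (frameVolume_pos hL) (frameVolume_id_pos x)

theorem absDet_inverse {x y : M} {L : TangentSpace (𝓡 d) x →L[ℝ] TangentSpace (𝓡 d) y}
    (hL : L.IsInvertible) : absDet L.inverse = (absDet L)⁻¹ := by
  have h1 := absDet_mul_frameVolume L.inverse (modelMap L)
  have h2 : modelMap L.inverse ∘L modelMap L = ContinuousLinearMap.id ℝ _ := by
    obtain ⟨e, rfl⟩ := hL
    rw [ContinuousLinearMap.inverse_equiv]
    ext1 v
    exact e.symm_apply_apply v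
  rw [h2] at h1
  refine eq_inv_of_mul_eq_one_left ?_
  rw [absDet_eq L, mul_div_assoc', h1]
  exact div_self (frameVolume_id_pos x).ne'

variable (d) in
/-- The derivative of the inverse of the preferred chart at `p`, in the model space. -/
def chartSymmDeriv (p : M) (y : EuclideanSpace ℝ (Fin d)) :
    EuclideanSpace ℝ (Fin d) →L[ℝ] EuclideanSpace ℝ (Fin d) :=
  letI : ChartedSpace (EuclideanSpace ℝ (Fin d)) (EuclideanSpace ℝ (Fin d)) := chartedSpaceSelf _
  mfderiv (𝓡 d) (𝓡 d) (extChartAt (𝓡 d) p).symm y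

theorem chartDensity_eq (p : M) (y : EuclideanSpace ℝ (Fin d)) :
    chartDensity d p y = frameVolume ((extChartAt (𝓡 d) p).symm y) (chartSymmDeriv d p y) :=
  rfl

variable [IsManifold (𝓡 d) 1 M]

omit [RiemannianBundle (fun x : M ↦ TangentSpace (𝓡 d) x)] in
theorem isInvertible_chartSymmDeriv {p : M} {y : EuclideanSpace ℝ (Fin d)}
    (hy : y ∈ (extChartAt (𝓡 d) p).target) : (chartSymmDeriv d p y).IsInvertible := by
  have := isInvertible_mfderivWithin_extChartAt_symm (I := 𝓡 d) hy
  rwa [modelWithCornersSelf_coe, range_id, mfderivWithin_univ] at this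

theorem chartDensity_pos {p : M} {y : EuclideanSpace ℝ (Fin d)}
    (hy : y ∈ (extChartAt (𝓡 d) p).target) : 0 < chartDensity d p y :=
  frameVolume_pos (isInvertible_chartSymmDeriv hy)

/-- The Jacobian of a map in charts. -/
theorem exists_hasFDerivAt_writtenInCharts {f : M → M} {p q : M} {y : EuclideanSpace ℝ (Fin d)}
    (hy : y ∈ (extChartAt (𝓡 d) p).target)
    (hf : MDifferentiableAt (𝓡 d) (𝓡 d) f ((extChartAt (𝓡 d) p).symm y))
    (hfy : f ((extChartAt (𝓡 d) p).symm y) ∈ (extChartAt (𝓡 d) q).source) :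
    ∃ D : EuclideanSpace ℝ (Fin d) →L[ℝ] EuclideanSpace ℝ (Fin d),
      HasFDerivAt (extChartAt (𝓡 d) q ∘ f ∘ (extChartAt (𝓡 d) p).symm) D y ∧
      |D.det| * chartDensity d q (extChartAt (𝓡 d) q (f ((extChartAt (𝓡 d) p).symm y))) =
        absDet (mfderiv (𝓡 d) (𝓡 d) f ((extChartAt (𝓡 d) p).symm y)) * chartDensity d p y := by
  set φ := extChartAt (𝓡 d) p with hφ
  set ψ := extChartAt (𝓡 d) q with hψ
  set x := φ.symm y with hx
  have h1 : HasMFDerivAt (𝓡 d) (𝓡 d) φ.symm y (mfderiv (𝓡 d) (𝓡 d) φ.symm y) := by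
    have := mdifferentiableWithinAt_extChartAt_symm (I := 𝓡 d) hy
    rw [modelWithCornersSelf_coe, range_id, mdifferentiableWithinAt_univ] at this
    exact this.hasMFDerivAt
  have h2 : HasMFDerivAt (𝓡 d) (𝓡 d) ψ (f x) (mfderiv (𝓡 d) (𝓡 d) ψ (f x)) :=
    (mdifferentiableAt_extChartAt (by rwa [extChartAt_source] at hfy)).hasMFDerivAt
  have h3 := h2.comp y (hf.hasMFDerivAt.comp y h1)
  let P : EuclideanSpace ℝ (Fin d) →L[ℝ] EuclideanSpace ℝ (Fin d) := mfderiv (𝓡 d) (𝓡 d) ψ (f x)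
  refine ⟨P ∘L (modelMap (mfderiv (𝓡 d) (𝓡 d) f x) ∘L chartSymmDeriv d p y),
    h3.hasFDerivAt, ?_⟩
  have h4 : chartSymmDeriv d q (ψ (f x)) ∘L P = ContinuousLinearMap.id ℝ _ := by
    have := mfderivWithin_extChartAt_symm_comp_mfderiv_extChartAt' (I := 𝓡 d) hfy
    rwa [modelWithCornersSelf_coe, range_id, mfderivWithin_univ] at this
  rw [chartDensity_eq q, ← frameVolume_comp, ← ContinuousLinearMap.comp_assoc, h4,
    ContinuousLinearMap.id_comp, ← hψ, ψ.left_inv hfy, chartDensity_eq p, ← hφ, ← hx,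
    absDet_mul_frameVolume]

end GramDeterminant

/-! ### Jacobians of a map with respect to a measure -/

section Jacobian

variable {M : Type*} [MetricSpace M] [CompactSpace M] [MeasurableSpace M] [BorelSpace M]

/-- Cut $A$ into countably many disjoint measurable pieces, each inside one of the sets $U$. Since
$f$ is injective on $A$, the images of the pieces are disjoint and measurable too, so both sides of
each inequality add up. -/
theorem isJacobian_of_locally {f : M → M} (hfc : Continuous f) {S : Set M}
    {m : Measure M} {J : M → ℝ}
    (h : ∀ y ∉ S, ∃ U : Set M, IsOpen U ∧ y ∈ U ∧ ∀ A, MeasurableSet A → A ⊆ U → A ⊆ Sᶜ →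
      InjOn f A → ∀ a : ℝ,
        ((∀ x ∈ A, a ≤ J x) → ENNReal.ofReal a * m A ≤ m (f '' A)) ∧
        ((∀ x ∈ A, J x ≤ a) → m (f '' A) ≤ ENNReal.ofReal a * m A)) :
    IsJacobian f S m J := by
  choose! U hUo hyU hU using h
  intro A hA hAS hinj a
  obtain ⟨t, htS, htc, ht⟩ := TopologicalSpace.countable_cover_nhdsWithin (s := Sᶜ) (f := U)
    fun x hx ↦ mem_nhdsWithin_of_mem_nhds ((hUo x hx).mem_nhds (hyU x hx))
  rcases A.eq_empty_or_nonempty with rfl | ⟨x₀, hx₀⟩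
  · simp
  obtain ⟨z, hz⟩ : ∃ z : ℕ → M, t = range z := by
    refine htc.exists_eq_range ?_
    obtain ⟨i, hi, -⟩ := mem_iUnion₂.1 (ht (hAS hx₀))
    exact ⟨i, hi⟩
  have hzS : ∀ n, z n ∉ S := fun n ↦ htS (hz ▸ mem_range_self n)
  set D : ℕ → Set M := disjointed fun n ↦ U (z n) with hD
  have hDm : ∀ n, MeasurableSet (D n) :=
    MeasurableSet.disjointed fun n ↦ (hUo _ (hzS n)).measurableSet
  have hDU : ∀ n, D n ⊆ U (z n) := fun n ↦ disjointed_subset _ n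
  have hAD : A = ⋃ n, A ∩ D n := by
    rw [← inter_iUnion, iUnion_disjointed, eq_comm, inter_eq_left]
    refine hAS.trans (ht.trans ?_)
    rw [hz, biUnion_range]
  have hdis : Pairwise (Function.onFun Disjoint fun n ↦ A ∩ D n) := fun i j hij ↦
    (disjoint_disjointed _ hij).mono inter_subset_right inter_subset_right
  have hm : ∀ n, MeasurableSet (A ∩ D n) := fun n ↦ hA.inter (hDm n)
  have hmA : m A = ∑' n, m (A ∩ D n) := by
    conv_lhs => rw [hAD]
    exact measure_iUnion hdis hm
  have hmf : m (f '' A) = ∑' n, m (f '' (A ∩ D n)) := by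
    conv_lhs => rw [hAD, image_iUnion]
    refine measure_iUnion (fun i j hij ↦ ?_) fun n ↦
      (hm n).image_of_continuousOn_injOn hfc.continuousOn (hinj.mono inter_subset_left)
    refine Set.disjoint_left.2 ?_
    rintro _ ⟨x, hx, rfl⟩ ⟨y, hy, hxy⟩
    exact Set.disjoint_left.1 (hdis hij) hx (hinj hy.1 hx.1 hxy ▸ hy)
  have key := fun n ↦ hU (z n) (hzS n) (A ∩ D n) (hm n) (inter_subset_right.trans (hDU n))
    (inter_subset_left.trans hAS) (hinj.mono inter_subset_left) a
  rw [hmA, hmf, ← ENNReal.tsum_mul_left]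
  exact ⟨fun ha ↦ ENNReal.tsum_le_tsum fun n ↦ (key n).1 fun x hx ↦ ha x hx.1,
    fun ha ↦ ENNReal.tsum_le_tsum fun n ↦ (key n).2 fun x hx ↦ ha x hx.1⟩

omit [MetricSpace M] [CompactSpace M] [BorelSpace M] in
theorem IsJacobian.smul {f : M → M} {S : Set M} {m : Measure M} {J : M → ℝ}
    (h : IsJacobian f S m J) (c : ℝ≥0∞) : IsJacobian f S (c • m) J := by
  intro A hA hAS hinj a
  obtain ⟨h1, h2⟩ := h A hA hAS hinj a
  simp only [Measure.smul_apply, smul_eq_mul, mul_left_comm (ENNReal.ofReal a) c]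
  exact ⟨fun ha ↦ mul_le_mul_right (h1 ha) _, fun ha ↦ mul_le_mul_right (h2 ha) _⟩

/-- A map with a Jacobian that is locally bounded below is nonsingular. -/
theorem IsJacobian.measure_preimage_eq_zero {f : M → M} (hfc : Continuous f) {S : Set M}
    (hf : IsLocalHomeomorphOn f Sᶜ) (hS : IsClosed S) {m : Measure M} (hmS : m S = 0) {J : M → ℝ}
    (h : IsJacobian f S m J)
    (hJ : ∀ x ∉ S, ∃ a > 0, ∀ᶠ y in 𝓝 x, a ≤ J y) {Z : Set M} (hZ : m Z = 0) :
    m (f ⁻¹' Z) = 0 := by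
  set Z' := toMeasurable m Z with hZ'
  have hZ0 : m Z' = 0 := by rw [hZ', measure_toMeasurable, hZ]
  have hZm : MeasurableSet Z' := measurableSet_toMeasurable _ _
  -- Near $x$ the map is injective with Jacobian at least $a>0$, so $a\,m(U\cap f^{-1}Z')\le
  -- m(Z')=0$. Countably many such $U$ cover the complement of $\mathcal S$.
  have key : ∀ x ∈ Sᶜ, ∃ U ∈ 𝓝[Sᶜ] x, m (U ∩ f ⁻¹' Z') = 0 := by
    intro x hx
    obtain ⟨a, ha, haJ⟩ := hJ x hx
    obtain ⟨e, hxe, hfe⟩ := hf x hx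
    have hs1 : ∀ᶠ y in 𝓝 x, y ∈ e.source := e.open_source.mem_nhds hxe
    have hs2 : ∀ᶠ y in 𝓝 x, y ∈ Sᶜ := hS.isOpen_compl.mem_nhds hx
    obtain ⟨U, hUsub, hUo, hxU⟩ := eventually_nhds_iff.1
      (haJ.and (hs1.and hs2))
    refine ⟨U, mem_nhdsWithin_of_mem_nhds (hUo.mem_nhds hxU), ?_⟩
    have hm : MeasurableSet (U ∩ f ⁻¹' Z') := hUo.measurableSet.inter (hfc.measurable hZm)
    have h1 := (h _ hm (fun y hy ↦ (hUsub y hy.1).2.2)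
      (by rw [hfe]; exact e.injOn.mono fun y hy ↦ (hUsub y hy.1).2.1) a).1
      fun y hy ↦ (hUsub y hy.1).1
    have h2 : m (f '' (U ∩ f ⁻¹' Z')) = 0 :=
      measure_mono_null (by rintro _ ⟨y, hy, rfl⟩; exact hy.2) hZ0
    rw [h2, nonpos_iff_eq_zero, mul_eq_zero] at h1
    exact h1.resolve_left (ENNReal.ofReal_pos.2 ha).ne'
  choose! U hU hU0 using key
  obtain ⟨t, htS, htc, ht⟩ := TopologicalSpace.countable_cover_nhdsWithin hU
  refine measure_mono_null (t := S ∪ ⋃ x ∈ t, U x ∩ f ⁻¹' Z') (fun x hx ↦ ?_) ?_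
  · by_cases hxS : x ∈ S
    · exact Or.inl hxS
    · obtain ⟨i, hi, hxi⟩ := mem_iUnion₂.1 (ht hxS)
      exact Or.inr (mem_biUnion hi ⟨hxi, subset_toMeasurable _ _ hx⟩)
  · exact measure_union_null hmS ((measure_biUnion_null_iff htc).2 fun x hx ↦ hU0 x (htS hx))

end Jacobian

/-! ### Riemannian volume and change of variables -/

section Volume

variable {d : ℕ} {M : Type*} [MetricSpace M] [MeasurableSpace M] [BorelSpace M]
  [ChartedSpace (EuclideanSpace ℝ (Fin d)) M]
  [RiemannianBundle (fun x : M ↦ TangentSpace (𝓡 d) x)]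

omit [RiemannianBundle (fun x : M ↦ TangentSpace (𝓡 d) x)] in
theorem measurableSet_target_inter_preimage (p : M) {A : Set M} (hA : MeasurableSet A) :
    MeasurableSet ((extChartAt (𝓡 d) p).target ∩ (extChartAt (𝓡 d) p).symm ⁻¹' A) := by
  have h1 : Measurable ((extChartAt (𝓡 d) p).target.domRestrict (extChartAt (𝓡 d) p).symm) :=
    (continuousOn_iff_continuous_domRestrict.1 (continuousOn_extChartAt_symm p)).measurable
  have h2 := (isOpen_extChartAt_target (I := 𝓡 d) p).measurableSet.subtype_image (h1 hA)
  convert h2 using 1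
  ext y
  simp [domRestrict, and_comm]

theorem chartVolume_apply (p : M) {A : Set M} (hA : MeasurableSet A) :
    chartVolume d p A = ∫⁻ y in (extChartAt (𝓡 d) p).target ∩ (extChartAt (𝓡 d) p).symm ⁻¹' A,
      ENNReal.ofReal (chartDensity d p y) := by
  have hT : MeasurableSet (extChartAt (𝓡 d) p).target := (isOpen_extChartAt_target p).measurableSet
  have h1 : AEMeasurable (extChartAt (𝓡 d) p).symm
      (volume.restrict (extChartAt (𝓡 d) p).target) :=
    (continuousOn_extChartAt_symm p).aemeasurable hT
  have h2 : AEMeasurable (extChartAt (𝓡 d) p).symm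
      ((volume.restrict (extChartAt (𝓡 d) p).target).withDensity
        (fun y ↦ ENNReal.ofReal (chartDensity d p y))) :=
    h1.mono_ac (withDensity_absolutelyContinuous _ _)
  rw [chartVolume, Measure.map_apply_of_aemeasurable h2 hA, ← restrict_withDensity hT,
    Measure.restrict_apply₀' hT.nullMeasurableSet, inter_comm,
    withDensity_apply _ (measurableSet_target_inter_preimage p hA)]

theorem chartVolume_inter_source (p : M) {A : Set M} (hA : MeasurableSet A) :
    chartVolume d p (A ∩ (chartAt (EuclideanSpace ℝ (Fin d)) p).source) = chartVolume d p A := by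
  rw [chartVolume_apply p hA,
    chartVolume_apply p (hA.inter (chartAt (EuclideanSpace ℝ (Fin d)) p).open_source.measurableSet)]
  congr 2
  ext y
  simp only [mem_inter_iff, mem_preimage]
  refine ⟨fun h ↦ ⟨h.1, h.2.1⟩, fun h ↦ ⟨h.1, h.2, ?_⟩⟩
  rw [← extChartAt_source (𝓡 d)]
  exact (extChartAt (𝓡 d) p).map_target h.1

variable [IsManifold (𝓡 d) 1 M]

/-- Change of variables for maps between chart domains. -/
theorem chartVolume_image {f : M → M} {p q : M} {A : Set M} (hA : MeasurableSet A)
    (hAp : A ⊆ (chartAt (EuclideanSpace ℝ (Fin d)) p).source)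
    (hAq : f '' A ⊆ (chartAt (EuclideanSpace ℝ (Fin d)) q).source) (hfA : MeasurableSet (f '' A))
    (hinj : InjOn f A) (hf : ∀ x ∈ A, MDifferentiableAt (𝓡 d) (𝓡 d) f x) :
    chartVolume d q (f '' A) =
      ∫⁻ y in (extChartAt (𝓡 d) p).target ∩ (extChartAt (𝓡 d) p).symm ⁻¹' A,
        ENNReal.ofReal (absDet (mfderiv (𝓡 d) (𝓡 d) f ((extChartAt (𝓡 d) p).symm y))) *
          ENNReal.ofReal (chartDensity d p y) := by
  rw [← extChartAt_source (𝓡 d)] at hAp hAq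
  set φ := extChartAt (𝓡 d) p with hφ
  set ψ := extChartAt (𝓡 d) q with hψ
  set a := φ.target ∩ φ.symm ⁻¹' A with ha
  have ham : MeasurableSet a := measurableSet_target_inter_preimage p hA
  have hD : ∀ y ∈ a, ∃ D : EuclideanSpace ℝ (Fin d) →L[ℝ] EuclideanSpace ℝ (Fin d), _ := fun y hy ↦
    exists_hasFDerivAt_writtenInCharts hy.1 (hf _ hy.2) (hAq (mem_image_of_mem f hy.2))
  choose! D hD1 hD2 using hD
  have himage : (ψ ∘ f ∘ φ.symm) '' a = ψ.target ∩ ψ.symm ⁻¹' (f '' A) := by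
    ext z
    constructor
    · rintro ⟨y, hy, rfl⟩
      have := hAq (mem_image_of_mem f hy.2)
      refine ⟨ψ.map_source this, ?_⟩
      rw [mem_preimage, Function.comp_apply, Function.comp_apply, ψ.left_inv this]
      exact mem_image_of_mem f hy.2
    · rintro ⟨hz, x, hx, hxz⟩
      refine ⟨φ x, ⟨φ.map_source (hAp hx), ?_⟩, ?_⟩
      · rw [mem_preimage, φ.left_inv (hAp hx)]; exact hx
      · rw [Function.comp_apply, Function.comp_apply, φ.left_inv (hAp hx), hxz, ψ.right_inv hz]
  have hinja : InjOn (ψ ∘ f ∘ φ.symm) a := by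
    intro y hy z hz hyz
    have h1 := ψ.injOn (hAq (mem_image_of_mem f hy.2)) (hAq (mem_image_of_mem f hz.2)) hyz
    exact φ.symm.injOn hy.1 hz.1 (hinj hy.2 hz.2 h1)
  rw [chartVolume_apply q hfA, ← hψ, ← himage,
    lintegral_image_eq_lintegral_abs_det_fderiv_mul volume ham
      (fun y hy ↦ (hD1 y hy).hasFDerivWithinAt) hinja]
  refine setLIntegral_congr_fun ham fun y hy ↦ ?_
  simp only [Function.comp_apply]
  rw [← ENNReal.ofReal_mul (abs_nonneg _), hD2 y hy, ENNReal.ofReal_mul]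
  rw [absDet_eq]
  exact div_nonneg (Real.sqrt_nonneg _) (Real.sqrt_nonneg _)

theorem chartVolume_image_bounds {f : M → M} {p q : M} {A : Set M} (hA : MeasurableSet A)
    (hAp : A ⊆ (chartAt (EuclideanSpace ℝ (Fin d)) p).source)
    (hAq : f '' A ⊆ (chartAt (EuclideanSpace ℝ (Fin d)) q).source) (hfA : MeasurableSet (f '' A))
    (hinj : InjOn f A) (hf : ∀ x ∈ A, MDifferentiableAt (𝓡 d) (𝓡 d) f x) (a : ℝ) :
    ((∀ x ∈ A, a ≤ absDet (mfderiv (𝓡 d) (𝓡 d) f x)) →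
      ENNReal.ofReal a * chartVolume d p A ≤ chartVolume d q (f '' A)) ∧
    ((∀ x ∈ A, absDet (mfderiv (𝓡 d) (𝓡 d) f x) ≤ a) →
      chartVolume d q (f '' A) ≤ ENNReal.ofReal a * chartVolume d p A) := by
  rw [chartVolume_image hA hAp hAq hfA hinj hf, chartVolume_apply p hA,
    ← lintegral_const_mul' _ _ ENNReal.ofReal_ne_top]
  have ham := measurableSet_target_inter_preimage (d := d) p hA
  refine ⟨fun h ↦ setLIntegral_mono' ham fun y hy ↦ ?_,
    fun h ↦ setLIntegral_mono' ham fun y hy ↦ ?_⟩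
  · gcongr
    exact h _ hy.2
  · gcongr
    exact h _ hy.2

/-- This is the change of variables formula for the identity map, whose determinant is 1. It makes
the volumes of different charts consistent on overlaps. -/
theorem chartVolume_eq_of_subset {p q : M} {A : Set M} (hA : MeasurableSet A)
    (hAp : A ⊆ (chartAt (EuclideanSpace ℝ (Fin d)) p).source)
    (hAq : A ⊆ (chartAt (EuclideanSpace ℝ (Fin d)) q).source) :
    chartVolume d q A = chartVolume d p A := by
  have h1 : ∀ x : M, absDet (mfderiv (𝓡 d) (𝓡 d) (id : M → M) x) = 1 := by
    intro x
    rw [mfderiv_id, absDet_eq]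
    exact div_self (frameVolume_id_pos x).ne'
  have h2 := chartVolume_image_bounds (f := (id : M → M)) (p := p) (q := q) hA hAp
    (by rwa [image_id]) (by rwa [image_id]) (injOn_id A) (fun x _ ↦ mdifferentiableAt_id) 1
  simp only [h1, image_id, le_refl, implies_true, ENNReal.ofReal_one, one_mul,
    forall_const] at h2
  exact le_antisymm h2.2 h2.1

/-- On the domain of a chart the Riemannian volume is the volume in the chart. -/
theorem riemannianVolume_eq_chartVolume [CompactSpace M] {p : M} {A : Set M} (hA : MeasurableSet A)
    (hAp : A ⊆ (chartAt (EuclideanSpace ℝ (Fin d)) p).source) :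
    riemannianVolume d M A = chartVolume d p A := by
  refine le_antisymm ?_ (le_iSup (fun p : M ↦ chartVolume d p) p A)
  let s : M → Set M := fun p ↦ (chartAt (EuclideanSpace ℝ (Fin d)) p).source
  obtain ⟨t, htc, ht⟩ := TopologicalSpace.countable_cover_nhds (f := s)
    fun x ↦ chart_source_mem_nhds (EuclideanSpace ℝ (Fin d)) x
  obtain ⟨z, hz⟩ : ∃ z : ℕ → M, t = range z := by
    refine htc.exists_eq_range ?_
    obtain ⟨i, hi, -⟩ := mem_iUnion₂.1 (ht.ge (mem_univ p))
    exact ⟨i, hi⟩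
  set D : ℕ → Set M := disjointed fun n ↦ s (z n) with hD
  have hDm : ∀ n, MeasurableSet (D n) :=
    MeasurableSet.disjointed fun n ↦ (chartAt _ (z n)).open_source.measurableSet
  have hDs : ∀ n, D n ⊆ s (z n) := fun n ↦ disjointed_subset _ n
  have hDu : ⋃ n, D n = univ := by
    rw [iUnion_disjointed, ← ht, hz, biUnion_range]
  -- A competitor for the supremum, glued from pieces $D_n$ of chart domains that partition $M$. By
  -- consistency on overlaps it dominates every chart volume, and on subsets of the domain at $p$ it
  -- equals the volume of that chart.
  let ν : Measure M := Measure.sum fun n ↦ (chartVolume d (z n)).restrict (D n)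
  have hν : ∀ B, MeasurableSet B → ν B = ∑' n, chartVolume d (z n) (B ∩ D n) := fun B hB ↦ by
    rw [Measure.sum_apply _ hB]
    exact tsum_congr fun n ↦ Measure.restrict_apply hB
  have hle : riemannianVolume d M ≤ ν := by
    refine iSup_le fun q ↦ Measure.le_iff.2 fun B hB ↦ ?_
    calc chartVolume d q B = chartVolume d q (⋃ n, B ∩ D n) := by
          rw [← inter_iUnion, hDu, inter_univ]
      _ ≤ ∑' n, chartVolume d q (B ∩ D n) := measure_iUnion_le _
      _ ≤ ∑' n, chartVolume d (z n) (B ∩ D n) := ENNReal.tsum_le_tsum fun n ↦ by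
          have hm : MeasurableSet (B ∩ D n) := hB.inter (hDm n)
          rw [← chartVolume_inter_source q hm, chartVolume_eq_of_subset (p := z n)
            (hm.inter (chartAt _ q).open_source.measurableSet)
            (inter_subset_left.trans (inter_subset_right.trans (hDs n))) inter_subset_right]
          exact measure_mono inter_subset_left
      _ = ν B := (hν B hB).symm
  refine (hle A).trans ?_
  rw [hν A hA]
  calc ∑' n, chartVolume d (z n) (A ∩ D n) = ∑' n, chartVolume d p (A ∩ D n) :=
        tsum_congr fun n ↦ chartVolume_eq_of_subset (hA.inter (hDm n))
          (inter_subset_left.trans hAp) (inter_subset_right.trans (hDs n))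
    _ = chartVolume d p (⋃ n, A ∩ D n) := (measure_iUnion (fun i j hij ↦
        (disjoint_disjointed _ hij).mono inter_subset_right inter_subset_right)
        fun n ↦ hA.inter (hDm n)).symm
    _ ≤ chartVolume d p A := measure_mono (iUnion_subset fun n ↦ inter_subset_left)

/-- The Riemannian determinant is the Jacobian with respect to the Riemannian volume. -/
theorem isJacobian_riemannianVolume [CompactSpace M] {f : M → M} (hfc : Continuous f) {S : Set M}
    (hf : ∀ x ∉ S, MDifferentiableAt (𝓡 d) (𝓡 d) f x) :
    IsJacobian f S (riemannianVolume d M) fun x ↦ absDet (mfderiv (𝓡 d) (𝓡 d) f x) := by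
  refine isJacobian_of_locally hfc fun y _ ↦ ⟨(chartAt (EuclideanSpace ℝ (Fin d)) y).source ∩
    f ⁻¹' (chartAt (EuclideanSpace ℝ (Fin d)) (f y)).source,
    (chartAt _ y).open_source.inter ((chartAt _ (f y)).open_source.preimage hfc),
    ⟨mem_chart_source _ y, mem_chart_source _ (f y)⟩, fun A hA hAU hAS hinj a ↦ ?_⟩
  have hfA : MeasurableSet (f '' A) := hA.image_of_continuousOn_injOn hfc.continuousOn hinj
  have h1 : f '' A ⊆ (chartAt (EuclideanSpace ℝ (Fin d)) (f y)).source := by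
    rintro _ ⟨x, hx, rfl⟩; exact (hAU hx).2
  have h2 := hAU.trans inter_subset_left
  rw [riemannianVolume_eq_chartVolume hA h2, riemannianVolume_eq_chartVolume hfA h1]
  exact chartVolume_image_bounds hA h2 h1 hfA hinj (fun x hx ↦ hf x (hAS hx)) a

end Volume

/-! ### Regularity of the density, finiteness of the volume, and null submanifolds -/

section Density

theorem ContMDiffOn.contMDiffOn_mfderiv_apply {E : Type*} [NormedAddCommGroup E] [NormedSpace ℝ E]
    {M : Type*} [TopologicalSpace M] [ChartedSpace E M] [IsManifold 𝓘(ℝ, E) ∞ M] {g : E → M}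
    {s : Set E} (hs : IsOpen s) (hg : ContMDiffOn 𝓘(ℝ, E) 𝓘(ℝ, E) ∞ g s) (v : E) :
    ContMDiffOn 𝓘(ℝ, E) (𝓘(ℝ, E).prod 𝓘(ℝ, E)) 1
      (fun y ↦ (⟨g y, mfderiv 𝓘(ℝ, E) 𝓘(ℝ, E) g y v⟩ : TangentBundle 𝓘(ℝ, E) M)) s := by
  have h2 := hg.contMDiffOn_tangentMapWithin (m := 1) (by norm_cast) hs.uniqueMDiffOn
  have h3 : ContMDiff 𝓘(ℝ, E) (𝓘(ℝ, E).prod 𝓘(ℝ, E)) 1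
      (fun y : E ↦ (⟨y, v⟩ : TangentBundle 𝓘(ℝ, E) E)) :=
    contMDiff_vectorSpace_iff_contDiff.2 contDiff_const
  refine (h2.comp (h3.contMDiffOn (s := s)) fun y hy ↦ hy).congr fun y hy ↦ ?_
  simp only [Function.comp_apply, tangentMapWithin]
  rw [mfderivWithin_of_isOpen hs hy]

variable {d : ℕ} {M : Type*} [MetricSpace M]
  [ChartedSpace (EuclideanSpace ℝ (Fin d)) M] [IsManifold (𝓡 d) ∞ M]
  [RiemannianBundle (fun x : M ↦ TangentSpace (𝓡 d) x)]
  [IsContMDiffRiemannianBundle (𝓡 d) ∞ (EuclideanSpace ℝ (Fin d))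
      (fun x : M ↦ TangentSpace (𝓡 d) x)]

omit [RiemannianBundle (fun x : M ↦ TangentSpace (𝓡 d) x)]
  [IsContMDiffRiemannianBundle (𝓡 d) ∞ (EuclideanSpace ℝ (Fin d))
      (fun x : M ↦ TangentSpace (𝓡 d) x)] in
theorem contMDiffOn_chartFrame (p : M) (i : Fin d) :
    letI : ChartedSpace (EuclideanSpace ℝ (Fin d)) (EuclideanSpace ℝ (Fin d)) := chartedSpaceSelf _
    ContMDiffOn (𝓡 d) ((𝓡 d).prod (𝓡 d)) 1
      (fun y ↦ (⟨(extChartAt (𝓡 d) p).symm y, chartFrame d p y i⟩ :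
        TangentBundle (𝓡 d) M)) (extChartAt (𝓡 d) p).target := by
  let _ : ChartedSpace (EuclideanSpace ℝ (Fin d)) (EuclideanSpace ℝ (Fin d)) := chartedSpaceSelf _
  exact (contMDiffOn_extChartAt_symm p).contMDiffOn_mfderiv_apply (isOpen_extChartAt_target p) _

/-- The Gram entries are inner products of $C^1$ fields, and the square root is taken of a positive
function. One derivative is what the Lipschitz estimate for the log-Jacobian needs. -/
theorem contDiffOn_chartDensity (p : M) :
    ContDiffOn ℝ 1 (chartDensity d p) (extChartAt (𝓡 d) p).target := by
  have h1 : ∀ i j, ContDiffOn ℝ 1 (fun y ↦ inner ℝ (chartFrame d p y i) (chartFrame d p y j))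
      (extChartAt (𝓡 d) p).target := fun i j ↦ by
    let _ : ChartedSpace (EuclideanSpace ℝ (Fin d)) (EuclideanSpace ℝ (Fin d)) := chartedSpaceSelf _
    have : IsContMDiffRiemannianBundle (𝓡 d) 1 (EuclideanSpace ℝ (Fin d))
      (fun x : M ↦ TangentSpace (𝓡 d) x) := .of_le (n := ∞) (by norm_cast)
    exact ContMDiffOn.contDiffOn
      ((contMDiffOn_chartFrame p i).inner_bundle (contMDiffOn_chartFrame p j))
  have h2 : ContDiffOn ℝ 1 (fun y ↦ (Matrix.gram ℝ (chartFrame d p y)).det)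
      (extChartAt (𝓡 d) p).target := by
    simp only [Matrix.det_apply, Matrix.gram_apply]
    exact ContDiffOn.sum fun τ _ ↦ (ContDiffOn.const_smul _ (contDiffOn_prod fun i _ ↦ h1 _ _))
  refine h2.sqrt fun y hy ↦ ?_
  exact (Real.sqrt_pos.1 (chartDensity_pos hy)).ne'

variable [MeasurableSpace M] [BorelSpace M]

theorem exists_mem_nhds_chartVolume_lt_top (p : M) : ∃ U ∈ 𝓝 p, chartVolume d p U < ⊤ := by
  set φ := extChartAt (𝓡 d) p with hφ
  have hc : ContinuousAt (chartDensity d p) (φ p) :=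
    (contDiffOn_chartDensity p).continuousOn.continuousAt (extChartAt_target_mem_nhds p)
  have h1 : ∀ᶠ y in 𝓝 (φ p), chartDensity d p y ≤ chartDensity d p (φ p) + 1 :=
    (hc.eventually (gt_mem_nhds (lt_add_one _))).mono fun _ ↦ le_of_lt
  obtain ⟨r, hr, hrs⟩ := Metric.eventually_nhds_iff_ball.1 h1
  have h2 : ∀ᶠ x in 𝓝 p, x ∈ φ.source := extChartAt_source_mem_nhds (I := 𝓡 d) p
  have h3 : ∀ᶠ x in 𝓝 p, x ∈ φ.source ∧ φ x ∈ Metric.ball (φ p) r :=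
    h2.and ((continuousAt_extChartAt p).preimage_mem_nhds (Metric.ball_mem_nhds _ hr))
  obtain ⟨U, hU, hUo, hpU⟩ := eventually_nhds_iff.1 h3
  refine ⟨U, hUo.mem_nhds hpU, ?_⟩
  have hsub : φ.target ∩ φ.symm ⁻¹' U ⊆ Metric.ball (φ p) r := fun y hy ↦ by
    have := (hU _ hy.2).2
    rwa [φ.right_inv hy.1] at this
  rw [chartVolume_apply p hUo.measurableSet]
  calc _ ≤ ∫⁻ _ in φ.target ∩ φ.symm ⁻¹' U, ENNReal.ofReal (chartDensity d p (φ p) + 1) :=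
        setLIntegral_mono' (measurableSet_target_inter_preimage p hUo.measurableSet) fun y hy ↦
          ENNReal.ofReal_le_ofReal (hrs y (hsub hy))
    _ = ENNReal.ofReal (chartDensity d p (φ p) + 1) * volume (φ.target ∩ φ.symm ⁻¹' U) := by
        rw [setLIntegral_const]
    _ ≤ ENNReal.ofReal (chartDensity d p (φ p) + 1) * volume (Metric.ball (φ p) r) := by gcongr
    _ < ⊤ := ENNReal.mul_lt_top ENNReal.ofReal_lt_top measure_ball_lt_top

theorem riemannianVolume_univ_lt_top [CompactSpace M] : riemannianVolume d M univ < ⊤ := by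
  refine isCompact_univ.measure_lt_top_of_nhdsWithin fun p _ ↦ ?_
  rw [nhdsWithin_univ]
  obtain ⟨U, hU, hUt⟩ := exists_mem_nhds_chartVolume_lt_top (d := d) p
  set s := (chartAt (EuclideanSpace ℝ (Fin d)) p).source with hs
  have hsn : s ∈ 𝓝 p := chart_source_mem_nhds (EuclideanSpace ℝ (Fin d)) p
  obtain ⟨V, hVsub, hVo, hpV⟩ := mem_nhds_iff.1 (inter_mem hU hsn)
  refine ⟨V, hVo.mem_nhds hpV, ?_⟩
  rw [riemannianVolume_eq_chartVolume hVo.measurableSet (hVsub.trans inter_subset_right)]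
  exact (measure_mono (hVsub.trans inter_subset_left)).trans_lt hUt

theorem riemannianVolume_pos_of_isOpen [CompactSpace M] {U : Set M} (hU : IsOpen U)
    (hne : U.Nonempty) : 0 < riemannianVolume d M U := by
  obtain ⟨p, hp⟩ := hne
  refine lt_of_lt_of_le ?_ (le_iSup (fun p : M ↦ chartVolume d p) p U)
  set φ := extChartAt (𝓡 d) p with hφ
  have hm := measurableSet_target_inter_preimage (d := d) p hU.measurableSet
  have ho : IsOpen (φ.target ∩ φ.symm ⁻¹' U) :=
    (continuousOn_extChartAt_symm p).isOpen_inter_preimage (isOpen_extChartAt_target p) hU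
  have hpo : φ p ∈ φ.target ∩ φ.symm ⁻¹' U :=
    ⟨mem_extChartAt_target p, by rwa [mem_preimage, hφ, extChartAt_to_inv]⟩
  have hc : AEMeasurable (fun y ↦ ENNReal.ofReal (chartDensity d p y))
      (volume.restrict (φ.target ∩ φ.symm ⁻¹' U)) :=
    (((contDiffOn_chartDensity p).continuousOn.mono inter_subset_left).aemeasurable hm).ennreal_ofReal
  rw [chartVolume_apply p hU.measurableSet, pos_iff_ne_zero, Ne, setLIntegral_eq_zero_iff' hm hc]
  intro h
  refine (ho.measure_pos volume ⟨_, hpo⟩).ne' (measure_mono_null (fun y hy ↦ ?_) h)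
  exact fun h0 ↦ (ENNReal.ofReal_pos.2 (chartDensity_pos hy.1)).ne' (h0 hy)

-- Since $k<d$, the slice lies in the hyperplane on which coordinate $k$ vanishes. That is a null
-- set, and the differentiable transition map to the chart at $p$ preserves null sets.
omit [RiemannianBundle (fun x : M ↦ TangentSpace (𝓡 d) x)]
  [IsContMDiffRiemannianBundle (𝓡 d) ∞ (EuclideanSpace ℝ (Fin d))
      (fun x : M ↦ TangentSpace (𝓡 d) x)] [MeasurableSpace M] [BorelSpace M] in
theorem volume_preimage_slice_eq_zero {S : Set M}
    {e : OpenPartialHomeomorph M (EuclideanSpace ℝ (Fin d))}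
    (he : e ∈ IsManifold.maximalAtlas (𝓡 d) ∞ M) {k : ℕ} (hk : k < d)
    (h : ∀ q ∈ e.source, q ∈ S → ∀ i : Fin d, k ≤ (i : ℕ) → e q i = 0) (p : M) :
    volume ((extChartAt (𝓡 d) p).target ∩ (extChartAt (𝓡 d) p).symm ⁻¹' (S ∩ e.source)) = 0 := by
  let _ : ChartedSpace (EuclideanSpace ℝ (Fin d)) (EuclideanSpace ℝ (Fin d)) := chartedSpaceSelf _
  set φ := extChartAt (𝓡 d) p with hφ
  let i₀ : Fin d := ⟨k, hk⟩
  let V : Submodule ℝ (EuclideanSpace ℝ (Fin d)) :=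
    LinearMap.ker (EuclideanSpace.proj (𝕜 := ℝ) i₀ : EuclideanSpace ℝ (Fin d) →L[ℝ] ℝ).toLinearMap
  have hV : volume (V : Set (EuclideanSpace ℝ (Fin d))) = 0 := by
    refine Measure.addHaar_submodule _ _ fun htop ↦ ?_
    have : EuclideanSpace.single i₀ (1 : ℝ) ∈ V := htop ▸ Submodule.mem_top
    simp [V] at this
  set N : Set (EuclideanSpace ℝ (Fin d)) := (e.target ∩ e.symm ⁻¹' φ.source) ∩ V with hN
  have hdiff : DifferentiableOn ℝ (φ ∘ e.symm) N := by
    have h1 : ContMDiffOn (𝓡 d) (𝓡 d) ∞ (φ ∘ e.symm) (e.target ∩ e.symm ⁻¹' φ.source) := by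
      have h2 : ContMDiffOn (𝓡 d) (𝓡 d) ∞ φ φ.source := by
        rw [hφ, extChartAt_source]
        exact contMDiffOn_extChartAt
      have h3 : ContMDiffOn (𝓡 d) (𝓡 d) ∞ e.symm e.target :=
        contMDiffOn_symm_of_mem_maximalAtlas he
      exact h2.comp' h3
    exact (h1.contDiffOn.differentiableOn (by norm_num)).mono inter_subset_left
  refine measure_mono_null ?_ (addHaar_image_eq_zero_of_differentiableOn_of_addHaar_eq_zero
    volume hdiff (measure_mono_null inter_subset_right hV))
  rintro y ⟨hy, hyS, hye⟩
  refine ⟨e (φ.symm y), ⟨⟨e.map_source hye, ?_⟩, ?_⟩, ?_⟩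
  · rw [mem_preimage, e.left_inv hye]
    exact φ.map_target hy
  · exact h _ hye hyS i₀ le_rfl
  · rw [Function.comp_apply, e.left_inv hye, φ.right_inv hy]

omit [IsContMDiffRiemannianBundle (𝓡 d) ∞ (EuclideanSpace ℝ (Fin d))
      (fun x : M ↦ TangentSpace (𝓡 d) x)] in
theorem riemannianVolume_eq_zero_of_isLowerDimSubmanifold [CompactSpace M] {S : Set M}
    (hSc : IsClosed S) (hS : IsLowerDimSubmanifold d S) : riemannianVolume d M S = 0 := by
  refine measure_null_of_locally_null S fun p hp ↦ ?_
  obtain ⟨k, hk, e, he, hpe, hSe⟩ := hS p hp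
  set s := (chartAt (EuclideanSpace ℝ (Fin d)) p).source with hs
  refine ⟨S ∩ e.source ∩ s, inter_mem (inter_mem self_mem_nhdsWithin
    (mem_nhdsWithin_of_mem_nhds (e.open_source.mem_nhds hpe)))
    (mem_nhdsWithin_of_mem_nhds (chart_source_mem_nhds (EuclideanSpace ℝ (Fin d)) p)), ?_⟩
  have hm : MeasurableSet (S ∩ e.source) := hSc.measurableSet.inter e.open_source.measurableSet
  rw [riemannianVolume_eq_chartVolume (hm.inter (chartAt _ p).open_source.measurableSet)
    inter_subset_right, chartVolume_inter_source p hm, chartVolume_apply p hm]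
  exact setLIntegral_measure_zero _ _ (volume_preimage_slice_eq_zero he hk
    (fun q hq hqS ↦ (hSe q hq).1 hqS) p)

variable [CompactSpace M] [Nonempty M]

theorem isProbabilityMeasure_lebesgueMeasure : IsProbabilityMeasure (lebesgueMeasure d M) :=
  ⟨by
    rw [lebesgueMeasure, Measure.smul_apply, smul_eq_mul]
    exact ENNReal.inv_mul_cancel (riemannianVolume_pos_of_isOpen isOpen_univ univ_nonempty).ne'
      riemannianVolume_univ_lt_top.ne⟩

omit [Nonempty M] in
theorem isOpenPosMeasure_lebesgueMeasure : (lebesgueMeasure d M).IsOpenPosMeasure :=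
  ⟨fun U hU hne ↦ by
    rw [lebesgueMeasure, Measure.smul_apply, smul_eq_mul]
    exact mul_ne_zero (ENNReal.inv_ne_zero.2 riemannianVolume_univ_lt_top.ne)
      (riemannianVolume_pos_of_isOpen hU hne).ne'⟩

omit [IsContMDiffRiemannianBundle (𝓡 d) ∞ (EuclideanSpace ℝ (Fin d))
      (fun x : M ↦ TangentSpace (𝓡 d) x)] [Nonempty M] in
theorem lebesgueMeasure_eq_zero_of_isLowerDimSubmanifold {S : Set M}
    (hSc : IsClosed S) (hS : IsLowerDimSubmanifold d S) : lebesgueMeasure d M S = 0 := by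
  rw [lebesgueMeasure, Measure.smul_apply, smul_eq_mul,
    riemannianVolume_eq_zero_of_isLowerDimSubmanifold hSc hS, mul_zero]

end Density

/-! ### Local Lipschitz regularity of the log-Jacobian -/

section LogJacobian

theorem ContinuousLinearMap.contDiff_det {E : Type*} [NormedAddCommGroup E] [NormedSpace ℝ E]
    [FiniteDimensional ℝ E] {n : ℕ∞ω} : ContDiff ℝ n fun L : E →L[ℝ] E ↦ L.det := by
  let b := Module.finBasis ℝ E
  have h1 : ∀ L : E →L[ℝ] E, L.det = (LinearMap.toMatrix b b L.toLinearMap).det := fun L ↦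
    (LinearMap.det_toMatrix b L.toLinearMap).symm
  simp only [h1, Matrix.det_apply, LinearMap.toMatrix_apply]
  refine ContDiff.sum fun τ _ ↦ (contDiff_prod fun i _ ↦ ?_).const_smul _
  let ℓ : (E →L[ℝ] E) →ₗ[ℝ] ℝ :=
    { toFun := fun L ↦ b.repr (L (b i)) (τ i)
      map_add' := fun _ _ ↦ by simp
      map_smul' := fun _ _ ↦ by simp }
  exact (LinearMap.toContinuousLinearMap ℓ).contDiff

variable {d : ℕ} {M : Type*} [MetricSpace M]
  [ChartedSpace (EuclideanSpace ℝ (Fin d)) M]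

theorem IsLocalDiffeomorphAt.isInvertible_mfderiv [IsManifold (𝓡 d) ∞ M] {f : M → M} {x : M}
    (hf : IsLocalDiffeomorphAt (𝓡 d) (𝓡 d) 2 f x) :
    (mfderiv (𝓡 d) (𝓡 d) f x).IsInvertible :=
  ⟨hf.mfderivToContinuousLinearEquiv two_ne_zero,
    hf.mfderivToContinuousLinearEquiv_coe two_ne_zero⟩

theorem IsLocalDiffeomorphAt.eventually {f : M → M} {x : M}
    (hf : IsLocalDiffeomorphAt (𝓡 d) (𝓡 d) 2 f x) :
    ∀ᶠ y in 𝓝 x, IsLocalDiffeomorphAt (𝓡 d) (𝓡 d) 2 f y := by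
  obtain ⟨Φ, hx, hΦ⟩ := hf
  filter_upwards [Φ.open_source.mem_nhds hx] with y hy
  exact ⟨Φ, hy, hΦ⟩

variable [IsManifold (𝓡 d) ∞ M]
  [RiemannianBundle (fun x : M ↦ TangentSpace (𝓡 d) x)]
  [IsContMDiffRiemannianBundle (𝓡 d) ∞ (EuclideanSpace ℝ (Fin d))
      (fun x : M ↦ TangentSpace (𝓡 d) x)]

/-- In charts the Jacobian is $|\det DF|$ times a quotient of densities. The densities are $C^1$,
and $DF$ is $C^1$ because $F$ is $C^2$. -/
theorem contDiffAt_log_absDet_mfderiv {f : M → M} {x : M}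
    (hf : IsLocalDiffeomorphAt (𝓡 d) (𝓡 d) 2 f x) :
    ContDiffAt ℝ 1 ((fun y ↦ Real.log (absDet (mfderiv (𝓡 d) (𝓡 d) f y))) ∘
      (extChartAt (𝓡 d) x).symm) (extChartAt (𝓡 d) x x) := by
  set φ := extChartAt (𝓡 d) x with hφ
  set ψ := extChartAt (𝓡 d) (f x) with hψ
  set F := ψ ∘ f ∘ φ.symm with hF
  set y₀ := φ x with hy₀
  have hy₀t : y₀ ∈ φ.target := mem_extChartAt_target x
  have hsy : φ.symm y₀ = x := extChartAt_to_inv x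
  have hF2 : ContDiffAt ℝ 2 F y₀ := by
    have := (contMDiffAt_iff.1 hf.contMDiffAt).2
    rwa [modelWithCornersSelf_coe, range_id, contDiffWithinAt_univ] at this
  have hFy : F y₀ = ψ (f x) := by rw [hF, Function.comp_apply, Function.comp_apply, hsy]
  have hc : ContinuousAt φ.symm y₀ := continuousAt_extChartAt_symm x
  have hev : ∀ᶠ y in 𝓝 y₀, y ∈ φ.target ∧ IsLocalDiffeomorphAt (𝓡 d) (𝓡 d) 2 f (φ.symm y) ∧
      f (φ.symm y) ∈ ψ.source := by
    have h1 : ∀ᶠ y in 𝓝 y₀, y ∈ φ.target := extChartAt_target_mem_nhds x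
    have h2 : ∀ᶠ y in 𝓝 y₀, IsLocalDiffeomorphAt (𝓡 d) (𝓡 d) 2 f (φ.symm y) :=
      hc.eventually (by rw [hsy]; exact hf.eventually)
    have h3 : ∀ᶠ y in 𝓝 y₀, f (φ.symm y) ∈ ψ.source := by
      have : ContinuousAt (f ∘ φ.symm) y₀ :=
        ContinuousAt.comp (by rw [hsy]; exact hf.contMDiffAt.continuousAt) hc
      refine this.preimage_mem_nhds ?_
      rw [Function.comp_apply, hsy]
      exact extChartAt_source_mem_nhds (I := 𝓡 d) (f x)
    exact h1.and (h2.and h3)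
  -- No absolute value is needed around the determinant, because `Real.log` takes the same value at
  -- $t$ and $-t$.
  have key : ∀ y, y ∈ φ.target → IsLocalDiffeomorphAt (𝓡 d) (𝓡 d) 2 f (φ.symm y) →
      f (φ.symm y) ∈ ψ.source →
      (fderiv ℝ F y).det ≠ 0 ∧ Real.log (absDet (mfderiv (𝓡 d) (𝓡 d) f (φ.symm y))) =
        Real.log (fderiv ℝ F y).det + Real.log (chartDensity d (f x) (F y)) -
          Real.log (chartDensity d x y) := by
    intro y hy hfy hfs
    obtain ⟨D, hD, hD2⟩ := exists_hasFDerivAt_writtenInCharts hy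
      (hfy.contMDiffAt.mdifferentiableAt two_ne_zero) hfs
    have h1 := absDet_pos hfy.isInvertible_mfderiv
    have h2 : 0 < chartDensity d x y := chartDensity_pos hy
    have h3 : 0 < chartDensity d (f x) (F y) := chartDensity_pos (ψ.map_source hfs)
    have hD3 : |D.det| * chartDensity d (f x) (F y) =
      absDet (mfderiv (𝓡 d) (𝓡 d) f (φ.symm y)) * chartDensity d x y := hD2
    have hD0 : D.det ≠ 0 := fun h0 ↦ by
      rw [h0, abs_zero, zero_mul] at hD3
      exact (mul_pos h1 h2).ne hD3
    have hD' : fderiv ℝ F y = D := hD.fderiv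
    rw [hD']
    refine ⟨hD0, ?_⟩
    have := congrArg Real.log hD3
    rw [Real.log_mul (abs_ne_zero.2 hD0) h3.ne', Real.log_abs, Real.log_mul h1.ne' h2.ne'] at this
    linarith
  have h0 := key y₀ hev.self_of_nhds.1 hev.self_of_nhds.2.1 hev.self_of_nhds.2.2
  have hG : ContDiffAt ℝ 1 (fun y ↦ Real.log (fderiv ℝ F y).det +
      Real.log (chartDensity d (f x) (F y)) - Real.log (chartDensity d x y)) y₀ := by
    have h1 : ContDiffAt ℝ 1 (fderiv ℝ F) y₀ := hF2.fderiv_right (by norm_num)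
    have h2 : ContDiffAt ℝ 1 (chartDensity d x) y₀ :=
      (contDiffOn_chartDensity x).contDiffAt (extChartAt_target_mem_nhds x)
    have h3 : ContDiffAt ℝ 1 (chartDensity d (f x)) (F y₀) := by
      rw [hFy]
      exact (contDiffOn_chartDensity (f x)).contDiffAt (extChartAt_target_mem_nhds (f x))
    have h4 : F y₀ ∈ ψ.target := by rw [hFy]; exact mem_extChartAt_target (f x)
    refine ContDiffAt.sub (ContDiffAt.add ?_ ?_) (h2.log (chartDensity_pos hy₀t).ne')
    · exact (ContinuousLinearMap.contDiff_det.contDiffAt.comp y₀ h1).log h0.1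
    · exact (h3.comp y₀ (hF2.of_le one_le_two)).log (chartDensity_pos h4).ne'
  refine hG.congr_of_eventuallyEq ?_
  filter_upwards [hev] with y hy
  exact (key y hy.1 hy.2.1 hy.2.2).2

/-- The logarithm of the Jacobian of a `C²` local diffeomorphism is locally Lipschitz. -/
theorem exists_log_absDet_lipschitz [IsRiemannianManifold (𝓡 d) M] {f : M → M} {x : M}
    (hf : IsLocalDiffeomorphAt (𝓡 d) (𝓡 d) 2 f x) :
    ∃ C : ℝ, 0 ≤ C ∧ ∃ U ∈ 𝓝 x, ∀ y ∈ U, ∀ z ∈ U,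
      |Real.log (absDet (mfderiv (𝓡 d) (𝓡 d) f y)) -
        Real.log (absDet (mfderiv (𝓡 d) (𝓡 d) f z))| ≤ C * dist y z := by
  obtain ⟨K, t, ht, hK⟩ := (contDiffAt_log_absDet_mfderiv hf).exists_lipschitzOnWith
  obtain ⟨L, U, hU, hL⟩ := exists_lipschitzOnWith_extChartAt d x
  refine ⟨K * L, by positivity, U ∩ (extChartAt (𝓡 d) x).source ∩ extChartAt (𝓡 d) x ⁻¹' t,
    inter_mem (inter_mem hU (extChartAt_source_mem_nhds x))
      ((continuousAt_extChartAt x).preimage_mem_nhds ht), ?_⟩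
  rintro y ⟨⟨hyU, hys⟩, hyt⟩ z ⟨⟨hzU, hzs⟩, hzt⟩
  have h1 := hK.dist_le_mul _ hyt _ hzt
  have h2 := hL.dist_le_mul _ hyU _ hzU
  rw [Function.comp_apply, Function.comp_apply, (extChartAt (𝓡 d) x).left_inv hys,
    (extChartAt (𝓡 d) x).left_inv hzs, Real.dist_eq] at h1
  calc _ ≤ _ := h1
    _ ≤ K * (L * dist y z) := by gcongr
    _ = K * L * dist y z := by ring

end LogJacobian

/-! ### Hyperbolic times: concatenation and bounded distortion -/

section HyperbolicTimes

variable {d : ℕ} {M : Type*} [MetricSpace M]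
  [ChartedSpace (EuclideanSpace ℝ (Fin d)) M]
  [RiemannianBundle (fun x : M ↦ TangentSpace (𝓡 d) x)]

/-- Consider the last $j$ iterates before time $l+k$. If $j\le k$ they belong to the orbit of
$f^l(x)$. Otherwise they split into all $k$ of these, contributing $\sigma^k$, and the last $j-k$
before time $l$; the distance condition only weakens, since $\sigma^{bj}\le\sigma^{b(j-k)}$. -/
theorem IsHyperbolicTime.add {f : M → M} {S : Set M} {b σ δ : ℝ} (hb : 0 ≤ b) (hσ0 : 0 < σ)
    (hσ1 : σ ≤ 1) {l k : ℕ} {x : M} (hl : IsHyperbolicTime d f S b σ δ l x)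
    (hk : IsHyperbolicTime d f S b σ δ k (f^[l] x)) : IsHyperbolicTime d f S b σ δ (l + k) x := by
  have hsum : ∀ j, f^[j] (f^[l] x) = f^[l + j] x := fun j ↦ by
    rw [add_comm, Function.iterate_add_apply]
  have hprod : ∀ a, ∏ j ∈ Finset.Ico a k, ‖derivInv (d := d) f (f^[j] (f^[l] x))‖ =
      ∏ j ∈ Finset.Ico (l + a) (l + k), ‖derivInv (d := d) f (f^[j] x)‖ := fun a ↦ by
    have h : ∀ j, ‖derivInv (d := d) f (f^[j] (f^[l] x))‖ = ‖derivInv (d := d) f (f^[l + j] x)‖ :=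
      fun j ↦ congrArg (fun z ↦ ‖derivInv (d := d) f z‖) (hsum j)
    rw [Finset.prod_congr rfl fun j _ ↦ h j]
    rw [add_comm l a, add_comm l k]
    exact (Finset.prod_Ico_add (fun j ↦ ‖derivInv (d := d) f (f^[j] x)‖) a k l)
  refine ⟨hl.1.trans (Nat.le_add_right _ _), fun j hj1 hj ↦ ?_⟩
  rcases le_or_gt j k with hjk | hjk
  · obtain ⟨h1, h2⟩ := hk.2 j hj1 hjk
    rw [hprod, ← Nat.add_sub_assoc hjk] at h1
    rw [hsum, ← Nat.add_sub_assoc hjk] at h2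
    exact ⟨h1, h2⟩
  · obtain ⟨i, rfl⟩ := Nat.exists_eq_add_of_lt hjk
    set i' := i + 1 with hi'
    have hil : i' ≤ l := by omega
    have e1 : l + k - (k + i + 1) = l - i' := by omega
    obtain ⟨h1, h2⟩ := hl.2 i' (by omega) hil
    obtain ⟨h3, -⟩ := hk.2 k hk.1 le_rfl
    rw [hprod, Nat.sub_self, add_zero] at h3
    rw [e1]
    constructor
    · rw [← Finset.prod_Ico_consecutive _ (Nat.sub_le l i') (Nat.le_add_right l k),
        show k + i + 1 = i' + k by omega, pow_add]
      exact mul_le_mul h1 h3 (Finset.prod_nonneg fun _ _ ↦ ContinuousLinearMap.opNorm_nonneg _) (by positivity)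
    · refine le_trans ?_ h2
      refine Real.rpow_le_rpow_of_exponent_ge hσ0 hσ1 ?_
      gcongr
      omega

variable [IsManifold (𝓡 d) ∞ M]

theorem norm_derivInv_pos [NeZero d] {f : M → M} {x : M}
    (hf : IsLocalDiffeomorphAt (𝓡 d) (𝓡 d) 2 f x) : 0 < ‖derivInv (d := d) f x‖ := by
  obtain ⟨e, he⟩ := hf.isInvertible_mfderiv
  have h1 : derivInv (d := d) f x = e.symm := by
    rw [derivInv, ← he, ContinuousLinearMap.inverse_equiv]
  have h2 : Nontrivial (TangentSpace (𝓡 d) x) :=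
    inferInstanceAs (Nontrivial (EuclideanSpace ℝ (Fin d)))
  obtain ⟨v, hv⟩ := exists_ne (0 : TangentSpace (𝓡 d) x)
  have h3 := (derivInv (d := d) f x).le_opNorm (e v)
  have h4 : derivInv (d := d) f x (e v) = v := by rw [h1]; exact e.symm_apply_apply v
  rw [h4] at h3
  exact pos_of_mul_pos_left ((norm_pos_iff.2 hv).trans_le h3) (norm_nonneg _)

theorem norm_derivInv_of_dim_eq_zero {M : Type*} [MetricSpace M]
    [ChartedSpace (EuclideanSpace ℝ (Fin 0)) M]
    [RiemannianBundle (fun x : M ↦ TangentSpace (𝓡 0) x)] (f : M → M) (x : M) :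
    ‖derivInv (d := 0) f x‖ = 0 := by
  have : Subsingleton (TangentSpace (𝓡 0) x) :=
    inferInstanceAs (Subsingleton (EuclideanSpace ℝ (Fin 0)))
  refine le_antisymm (ContinuousLinearMap.opNorm_le_bound _ le_rfl fun v ↦ ?_)
    (ContinuousLinearMap.opNorm_nonneg _)
  rw [Subsingleton.elim (derivInv (d := 0) f x v) 0, norm_zero, zero_mul]

theorem isLocallyExpandingAt_of_dim_eq_zero {M : Type*} [MetricSpace M]
    [ChartedSpace (EuclideanSpace ℝ (Fin 0)) M] (f : M → M) (κ : ℝ) (x : M) :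
    IsLocallyExpandingAt f κ x := by
  refine ⟨_, chart_source_mem_nhds (EuclideanSpace ℝ (Fin 0)) x, fun u hu v hv ↦ ?_⟩
  have : u = v := (chartAt (EuclideanSpace ℝ (Fin 0)) x).injOn hu hv (Subsingleton.elim _ _)
  simp [this]

variable [IsContMDiffRiemannianBundle (𝓡 d) ∞ (EuclideanSpace ℝ (Fin d))
      (fun x : M ↦ TangentSpace (𝓡 d) x)] [IsRiemannianManifold (𝓡 d) M]

/-- The factor $\theta>1$ makes the inequality strict, as local expansion requires, provided the
norm is positive. In dimension 0 all these norms vanish, but there the manifold is discrete and any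
rate works. -/
theorem isLocallyExpandingAt_of_norm_derivInv_le {f : M → M} {y z : M}
    (hf : IsLocalDiffeomorphAt (𝓡 d) (𝓡 d) 2 f y) {a θ : ℝ} (hθ : 1 < θ)
    (h : ‖derivInv (d := d) f y‖ ≤ a * ‖derivInv (d := d) f z‖) :
    IsLocallyExpandingAt f (θ * a * ‖derivInv (d := d) f z‖) y := by
  rcases Nat.eq_zero_or_pos d with rfl | hd
  · exact isLocallyExpandingAt_of_dim_eq_zero f _ y
  · have : NeZero d := ⟨hd.ne'⟩
    refine isLocallyExpandingAt_of_norm_derivInv_lt hf ?_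
    have h1 := norm_derivInv_pos hf
    nlinarith

variable [CompactSpace M]

-- Here both bounds on $b$ are used. With $t=s^{4bk}$ the distance to $\mathcal S$ is at least a
-- multiple of $t$; $b<1/2$ gives $s^{2k}\le t$, so the ball stays away from $\mathcal S$, and
-- $b<1/(4\beta)$ gives $s^k\le t^\beta$, so the nondegeneracy bound is of order $s^{2k}/s^k=s^k$.
omit [IsContMDiffRiemannianBundle (𝓡 d) ∞ (EuclideanSpace ℝ (Fin d))
      (fun x : M ↦ TangentSpace (𝓡 d) x)] [IsRiemannianManifold (𝓡 d) M] [CompactSpace M] in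
theorem exists_distortion_bound_of_nonempty [NeZero d] {f : M → M} {S : Set M}
    (hne : S.Nonempty)
    (hf : ∀ x ∉ S, IsLocalDiffeomorphAt (𝓡 d) (𝓡 d) 2 f x) {β : ℝ} (hβ : IsNondegenerate d f S β)
    {b : ℝ} (hb : b < min (1 / 2) (1 / (4 * β)))
    {s δ : ℝ} (hs0 : 0 < s) (hs1 : s < 1) (hδ : 0 < δ) :
    ∃ ρ > 0, ∃ C, ∀ z, ∀ k : ℕ, (s ^ 4) ^ (b * k) ≤ truncDist δ z S →
      ∀ y ∈ Metric.closedBall z (ρ * (s ^ 2) ^ k), y ∉ S ∧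
        ‖derivInv (d := d) f y‖ ≤ s⁻¹ * ‖derivInv (d := d) f z‖ ∧
        |Real.log (absDet (mfderiv (𝓡 d) (𝓡 d) f y)) -
          Real.log (absDet (mfderiv (𝓡 d) (𝓡 d) f z))| ≤ C * s ^ k := by
  obtain ⟨B, hB1, -, hN, hJ⟩ := hβ.bounds hne
  have hβ0 := hβ.pos
  obtain ⟨hb1, hb2⟩ := lt_min_iff.1 hb
  set c := min δ 1 with hc
  have hc0 : 0 < c := lt_min hδ one_pos
  have hcβ : 0 < c ^ β := Real.rpow_pos_of_pos hc0 β
  have hlog : 0 < -Real.log s := neg_pos.2 (Real.log_neg hs0 hs1)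
  have hB0 : 0 < B := one_pos.trans hB1
  -- The first bound keeps the ball within half the distance to $\mathcal S$; the second keeps the
  -- variation of $\log\|Df^{-1}\|$ below $-\log s$.
  set ρ := min (c / 4) (-Real.log s * c ^ β / B) with hρ
  have hρ0 : 0 < ρ := lt_min (by positivity) (by positivity)
  have hρ1 : ρ ≤ c / 4 := min_le_left _ _
  have hρ2 : B * ρ / c ^ β ≤ -Real.log s := by
    rw [div_le_iff₀ hcβ, ← le_div_iff₀' hB0]
    exact min_le_right _ _
  refine ⟨ρ, hρ0, B * ρ / c ^ β, fun z k hz y hy ↦ ?_⟩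
  set t := (s ^ 4) ^ (b * k) with ht
  have ht0 : 0 < t := Real.rpow_pos_of_pos (by positivity) _
  have hs4 : ∀ a : ℝ, (s ^ 4 : ℝ) ^ a = s ^ (4 * a) := fun a ↦ by
    rw [Real.rpow_mul hs0.le]; norm_cast
  have ht1 : (s ^ 2) ^ k ≤ t := by
    rw [ht, hs4, ← pow_mul, ← Real.rpow_natCast]
    refine Real.rpow_le_rpow_of_exponent_ge hs0 hs1.le ?_
    push_cast
    nlinarith [(Nat.cast_nonneg k : (0 : ℝ) ≤ k)]
  have ht2 : s ^ k ≤ t ^ β := by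
    rw [ht, hs4, ← Real.rpow_mul hs0.le, ← Real.rpow_natCast]
    refine Real.rpow_le_rpow_of_exponent_ge hs0 hs1.le ?_
    have h1 : b * (4 * β) < 1 := by rwa [lt_div_iff₀ (by positivity)] at hb2
    nlinarith [(Nat.cast_nonneg k : (0 : ℝ) ≤ k)]
  set D := Metric.infDist z S with hD
  -- If the distance is not truncated, $c\le1$ suffices; if it is, the distance exceeds $\delta\ge
  -- c$ while $t\le1$.
  have hDc : c * t ≤ D := by
    rw [truncDist] at hz
    split_ifs at hz with h
    · exact (mul_le_of_le_one_left ht0.le (min_le_right _ _)).trans hz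
    · have h1 : δ < D := by
        by_contra h2
        exact h ⟨hne, not_lt.1 h2⟩
      exact (mul_le_of_le_one_right hc0.le hz).trans ((min_le_left _ _).trans h1.le)
  have hD0 : 0 < D := (mul_pos hc0 ht0).trans_le hDc
  have hdist : dist z y ≤ ρ * (s ^ 2) ^ k := by rw [dist_comm]; exact hy
  have hdist2 : dist z y < D / 2 := by
    calc dist z y ≤ ρ * (s ^ 2) ^ k := hdist
      _ ≤ c / 4 * t := by gcongr
      _ < D / 2 := by nlinarith [mul_pos hc0 ht0]
  have hzS : z ∉ S := fun h ↦ hD0.ne' (Metric.infDist_zero_of_mem h)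
  have hyS : y ∉ S := fun h ↦ by linarith [Metric.infDist_le_dist_of_mem (x := z) h]
  have hbound : B * dist z y / D ^ β ≤ B * ρ / c ^ β * s ^ k := by
    have h1 : c ^ β * s ^ k ≤ D ^ β :=
      calc c ^ β * s ^ k ≤ c ^ β * t ^ β := by gcongr
        _ = (c * t) ^ β := (Real.mul_rpow hc0.le ht0.le).symm
        _ ≤ D ^ β := Real.rpow_le_rpow (by positivity) hDc hβ0.le
    calc B * dist z y / D ^ β ≤ B * (ρ * (s ^ 2) ^ k) / (c ^ β * s ^ k) := by gcongr
      _ = B * ρ / c ^ β * s ^ k := by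
        rw [pow_right_comm, sq]
        field_simp
  refine ⟨hyS, ?_, ?_⟩
  · have h1 := (hN z hzS y hyS hdist2).trans hbound
    have h2 : B * ρ / c ^ β * s ^ k ≤ -Real.log s :=
      (mul_le_of_le_one_right (by positivity) (pow_le_one₀ hs0.le hs1.le)).trans hρ2
    have h3 := norm_derivInv_pos (hf z hzS)
    rw [← Real.log_le_log_iff (norm_derivInv_pos (hf y hyS)) (by positivity),
      Real.log_mul (by positivity) h3.ne', Real.log_inv]
    linarith [(abs_le.1 h1).1]
  · have h1 := (hJ z hzS y hyS hdist2).trans hbound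
    rw [derivInv, derivInv, absDet_inverse (hf z hzS).isInvertible_mfderiv,
      absDet_inverse (hf y hyS).isInvertible_mfderiv, Real.log_inv, Real.log_inv] at h1
    rwa [neg_sub_neg] at h1

/-- Without a singular set compactness replaces nondegeneracy: $\log\|Df^{-1}\|$ is uniformly
continuous and the log-Jacobian is Lipschitz. -/
theorem exists_distortion_bound_of_empty {f : M → M}
    (hf : ∀ x, IsLocalDiffeomorphAt (𝓡 d) (𝓡 d) 2 f x)
    {s : ℝ} (hs0 : 0 < s) (hs1 : s < 1) :
    ∃ ρ > 0, ∃ C, ∀ z, ∀ k : ℕ, ∀ y ∈ Metric.closedBall z (ρ * (s ^ 2) ^ k),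
        ‖derivInv (d := d) f y‖ ≤ s⁻¹ * ‖derivInv (d := d) f z‖ ∧
        |Real.log (absDet (mfderiv (𝓡 d) (𝓡 d) f y)) -
          Real.log (absDet (mfderiv (𝓡 d) (𝓡 d) f z))| ≤ C * s ^ k := by
  have hN : ∃ r > 0, ∀ y z : M, dist y z < r →
      ‖derivInv (d := d) f y‖ ≤ s⁻¹ * ‖derivInv (d := d) f z‖ := by
    rcases Nat.eq_zero_or_pos d with rfl | hd
    · exact ⟨1, one_pos, fun y z _ ↦ by simp [norm_derivInv_of_dim_eq_zero]⟩
    · have : NeZero d := ⟨hd.ne'⟩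
      have hcont : Continuous fun y ↦ Real.log ‖derivInv (d := d) f y‖ :=
        continuous_iff_continuousAt.2 fun x ↦
          (continuousAt_norm_derivInv (hf x)).log (norm_derivInv_pos (hf x)).ne'
      obtain ⟨r, hr, h⟩ := Metric.uniformContinuous_iff.1
        (CompactSpace.uniformContinuous_of_continuous hcont) (-Real.log s)
        (neg_pos.2 (Real.log_neg hs0 hs1))
      refine ⟨r, hr, fun y z hyz ↦ ?_⟩
      have h1 := h hyz
      have h3 := norm_derivInv_pos (hf z)
      rw [← Real.log_le_log_iff (norm_derivInv_pos (hf y)) (by positivity),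
        Real.log_mul (by positivity) h3.ne', Real.log_inv]
      rw [Real.dist_eq] at h1
      linarith [(abs_lt.1 h1).2]
  have hJ : LocallyLipschitzOn univ fun y ↦ Real.log (absDet (mfderiv (𝓡 d) (𝓡 d) f y)) := by
    intro x _
    obtain ⟨C, hC, U, hU, h⟩ := exists_log_absDet_lipschitz (hf x)
    lift C to NNReal using hC
    rw [nhdsWithin_univ]
    exact ⟨C, U, hU, LipschitzOnWith.of_dist_le_mul h⟩
  obtain ⟨r, hr, hN⟩ := hN
  obtain ⟨K, hK⟩ := hJ.exists_lipschitzOnWith_of_compact isCompact_univ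
  refine ⟨r / 2, by positivity, K * (r / 2), fun z k y hy ↦ ?_⟩
  have hy' : dist y z ≤ r / 2 * (s ^ 2) ^ k := hy
  have h1 : (s ^ 2) ^ k ≤ s ^ k := by
    rw [← pow_mul]
    exact pow_le_pow_of_le_one hs0.le hs1.le (by omega)
  refine ⟨hN y z (hy'.trans_lt ?_), ?_⟩
  · have := mul_le_of_le_one_right (by positivity : 0 ≤ r / 2)
      (pow_le_one₀ (n := k) (by positivity) (pow_le_one₀ (n := 2) hs0.le hs1.le))
    linarith
  · have h2 := hK.dist_le_mul y (mem_univ _) z (mem_univ _)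
    rw [Real.dist_eq] at h2
    refine h2.trans ?_
    calc K * dist y z ≤ K * (r / 2 * s ^ k) := by gcongr; exact hy'.trans (by gcongr)
      _ = _ := by ring

/-- On a ball whose radius is a fixed multiple of the contraction gained at a hyperbolic time, the
derivative and the Jacobian have bounded distortion. -/
theorem exists_distortion_bound {f : M → M} {S : Set M} (hS : IsLowerDimSubmanifold d S)
    (hf : IsLocalDiffeomorphOn (𝓡 d) (𝓡 d) 2 f Sᶜ) {β : ℝ} (hβ : IsNondegenerate d f S β)
    {b : ℝ} (hb : b < min (1 / 2) (1 / (4 * β)))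
    {s δ : ℝ} (hs0 : 0 < s) (hs1 : s < 1) (hδ : 0 < δ) :
    ∃ ρ > 0, ∃ C, ∀ z, ∀ k : ℕ, (s ^ 4) ^ (b * k) ≤ truncDist δ z S →
      ∀ y ∈ Metric.closedBall z (ρ * (s ^ 2) ^ k), y ∉ S ∧
        ‖derivInv (d := d) f y‖ ≤ s⁻¹ * ‖derivInv (d := d) f z‖ ∧
        |Real.log (absDet (mfderiv (𝓡 d) (𝓡 d) f y)) -
          Real.log (absDet (mfderiv (𝓡 d) (𝓡 d) f z))| ≤ C * s ^ k := by
  rcases S.eq_empty_or_nonempty with rfl | hne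
  · obtain ⟨ρ, hρ, C, h⟩ := exists_distortion_bound_of_empty
      (fun x ↦ hf ⟨x, notMem_empty x⟩) hs0 hs1
    exact ⟨ρ, hρ, C, fun z k _ y hy ↦ ⟨notMem_empty y, h z k y hy⟩⟩
  · have : NeZero d := by
      obtain ⟨p, hp⟩ := hne
      obtain ⟨k, hk, -⟩ := hS p hp
      exact ⟨by omega⟩
    exact exists_distortion_bound_of_nonempty hne (fun x hx ↦ hf ⟨x, hx⟩) hβ hb hs0 hs1 hδ

/-- A hyperbolic time contracts by $\sigma^k=s^{4k}$ over its last $k$ steps. Giving up $s^{-2}$ per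
step leaves $s^{2k}$, which is exactly the radius on which distortion is controlled. -/
theorem exists_hasExpandingOrbit {f : M → M} {S : Set M} (hS : IsLowerDimSubmanifold d S)
    (hf : IsLocalDiffeomorphOn (𝓡 d) (𝓡 d) 2 f Sᶜ) {β : ℝ} (hβ : IsNondegenerate d f S β)
    {b : ℝ} (hb : b < min (1 / 2) (1 / (4 * β)))
    {σ δ : ℝ} (hσ0 : 0 < σ) (hσ1 : σ < 1) (hδ : 0 < δ) :
    ∃ ρ > 0, ∃ D, ∀ n x, IsHyperbolicTime d f S b σ δ n x →
      HasExpandingOrbit f S (fun y ↦ absDet (mfderiv (𝓡 d) (𝓡 d) f y)) ρ D n x := by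
  obtain ⟨s, hs0, hs1, rfl⟩ : ∃ s : ℝ, 0 < s ∧ s < 1 ∧ s ^ 4 = σ :=
    ⟨σ ^ (1 / 4 : ℝ), by positivity, Real.rpow_lt_one hσ0.le hσ1 (by norm_num), by
      rw [← Real.rpow_natCast, ← Real.rpow_mul hσ0.le]; norm_num⟩
  obtain ⟨ρ, hρ, C, h⟩ := exists_distortion_bound hS hf hβ hb hs0 hs1 hδ
  refine ⟨ρ, hρ, |C| * (1 - s)⁻¹, fun n x hx ↦ ?_⟩
  -- One factor $s^{-1}$ pays for the variation of $\|Df^{-1}\|$ on the ball, the other for the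
  -- strict inequality in local expansion.
  set κ : ℕ → ℝ := fun j ↦ s⁻¹ * s⁻¹ * ‖derivInv (d := d) f (f^[j] x)‖ with hκ
  have hprod : ∀ j < n, ∏ i ∈ Finset.Ico j n, κ i ≤ (s ^ 2) ^ (n - j) := by
    intro j hj
    have h1 := (hx.2 (n - j) (by omega) (by omega)).1
    rw [Nat.sub_sub_self hj.le] at h1
    rw [hκ, Finset.prod_mul_distrib, Finset.prod_const, Nat.card_Ico]
    calc _ ≤ (s⁻¹ * s⁻¹) ^ (n - j) * (s ^ 4) ^ (n - j) := by gcongr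
      _ = (s ^ 2) ^ (n - j) := by
        rw [← mul_pow]
        congr 1
        field_simp
  refine ⟨κ, fun j ↦ |C| * s ^ (n - j), fun j ↦
    mul_nonneg (by positivity) (ContinuousLinearMap.opNorm_nonneg _), fun j hj y hy ↦ ?_, ?_⟩
  · have h1 := (hx.2 (n - j) (by omega) (by omega)).2
    rw [Nat.sub_sub_self hj.le] at h1
    have hy' : y ∈ Metric.closedBall (f^[j] x) (ρ * (s ^ 2) ^ (n - j)) :=
      Metric.closedBall_subset_closedBall (by gcongr; exact hprod j hj) hy
    obtain ⟨hyS, h2, h3⟩ := h _ _ h1 y hy'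
    exact ⟨hyS, isLocallyExpandingAt_of_norm_derivInv_le (hf ⟨y, hyS⟩) (one_lt_inv₀ hs0 |>.2 hs1) h2,
      h3.trans (mul_le_mul_of_nonneg_right (le_abs_self C) (by positivity))⟩
  · rw [← Finset.mul_sum]
    gcongr
    have h1 : ∑ j ∈ Finset.range n, s ^ (n - j) ≤ ∑ j ∈ Finset.range n, s ^ (n - 1 - j) := by
      refine Finset.sum_le_sum fun j _ ↦ pow_le_pow_of_le_one hs0.le hs1.le (by omega)
    rw [Finset.sum_range_reflect (fun j ↦ s ^ j) n] at h1
    refine h1.trans ?_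
    rw [← tsum_geometric_of_lt_one hs0.le hs1]
    exact (summable_geometric_of_lt_one hs0.le hs1).sum_le_tsum _ fun _ _ ↦ by positivity

end HyperbolicTimes

end

/-! ### Proof of the theorem -/

theorem continuousAt_absDet_mfderiv {d : ℕ} {M : Type*} [MetricSpace M]
    [ChartedSpace (EuclideanSpace ℝ (Fin d)) M] [IsManifold (𝓡 d) ∞ M]
    [RiemannianBundle (fun x : M ↦ TangentSpace (𝓡 d) x)]
    [IsContMDiffRiemannianBundle (𝓡 d) ∞ (EuclideanSpace ℝ (Fin d))
      (fun x : M ↦ TangentSpace (𝓡 d) x)] {f : M → M} {x : M}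
    (hf : IsLocalDiffeomorphAt (𝓡 d) (𝓡 d) 2 f x) :
    ContinuousAt (fun y ↦ absDet (mfderiv (𝓡 d) (𝓡 d) f y)) x := by
  have h1 := (contDiffAt_log_absDet_mfderiv hf).continuousAt.comp (continuousAt_extChartAt x)
  refine (Real.continuous_exp.continuousAt.comp h1).congr ?_
  filter_upwards [hf.eventually, extChartAt_source_mem_nhds (I := 𝓡 d) x] with y hy hys
  refine Eq.trans ?_ (Real.exp_log (absDet_pos hy.isInvertible_mfderiv))
  exact congrArg (fun z ↦ Real.exp (Real.log (absDet (mfderiv (𝓡 d) (𝓡 d) f z))))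
    ((extChartAt (𝓡 d) x).left_inv hys)

theorem theoremt {d : ℕ} {M : Type*} [MetricSpace M] [CompactSpace M] [Nonempty M]
    [MeasurableSpace M] [BorelSpace M]
    [ChartedSpace (EuclideanSpace ℝ (Fin d)) M] [IsManifold (𝓡 d) ∞ M]
    [RiemannianBundle (fun x : M ↦ TangentSpace (𝓡 d) x)]
    [IsContMDiffRiemannianBundle (𝓡 d) ∞ (EuclideanSpace ℝ (Fin d))
      (fun x : M ↦ TangentSpace (𝓡 d) x)]
    [IsRiemannianManifold (𝓡 d) M]
    (f : M → M) (hf : Continuous f)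
    (S : Set M) (hSc : IsCompact S) (hS : IsLowerDimSubmanifold d S)
    (hfS : IsLocalDiffeomorphOn (𝓡 d) (𝓡 d) 2 f Sᶜ)
    (β : ℝ) (hβ : IsNondegenerate d f S β)
    (b : ℝ) (hb0 : 0 < b) (hb : b < min (1 / 2) (1 / (4 * β)))
    (σ δ : ℝ) (hσ0 : 0 < σ) (hσ1 : σ < 1) (hδ : 0 < δ)
    (hex : ∀ᵐ x ∂(lebesgueMeasure d M), ∃ n, IsHyperbolicTime d f S b σ δ n x)
    (hint : Integrable (fun x ↦ (firstHyperbolicTime d f S b σ δ x : ℝ)) (lebesgueMeasure d M)) :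
    ∃ μ : Measure M, IsProbabilityMeasure μ ∧ MeasurePreserving f μ μ ∧
      μ ≪ lebesgueMeasure d M ∧
      ∃ φ : ℕ → ℕ, StrictMono φ ∧ ∀ g : C(M, ℝ),
        Tendsto (fun i ↦ ∫ x, g x ∂(cesaroAverage f (lebesgueMeasure d M) (φ i))) atTop
          (𝓝 (∫ x, g x ∂μ)) := by
  have := isProbabilityMeasure_lebesgueMeasure (d := d) (M := M)
  have := isOpenPosMeasure_lebesgueMeasure (d := d) (M := M)
  have hS' := hSc.isClosed
  have hloc : IsLocalHomeomorphOn f Sᶜ := hfS.isLocalHomeomorphOn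
  have hJ : IsJacobian f S (lebesgueMeasure d M) fun x ↦ absDet (mfderiv (𝓡 d) (𝓡 d) f x) :=
    (isJacobian_riemannianVolume hf fun x hx ↦
      (hfS ⟨x, hx⟩).contMDiffAt.mdifferentiableAt two_ne_zero).smul _
  have hJ0 : ∀ x ∉ S, 0 < absDet (mfderiv (𝓡 d) (𝓡 d) f x) := fun x hx ↦
    absDet_pos (hfS ⟨x, hx⟩).isInvertible_mfderiv
  obtain ⟨ρ, hρ, D, hD⟩ := exists_hasExpandingOrbit hS hfS hβ hb hσ0 hσ1 hδ
  obtain ⟨C, hC, hCP⟩ := exists_measure_expandingOrbit_inter_preimage_le (D := D) hf hS' hloc hJ hJ0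
    hρ.le fun p ↦ exists_isShortlyContractible d p hρ
  refine exists_absolutelyContinuous_invariant hf (lebesgueMeasure d M) (fun Z hZ ↦ ?_)
    (P := IsHyperbolicTime d f S b σ δ) (fun l k x hl hk ↦ hl.add hb0.le hσ0 hσ1.le hk)
    (fun n x h ↦ h.1) hC
    (fun n A ↦ (measure_mono (inter_subset_inter_left _ fun x hx ↦ hD n x hx)).trans (hCP n A))
    hex hint
  -- Nonsingularity of $f$: the Jacobian is continuous and positive off $\mathcal S$, hence near $x$
  -- at least half its value at $x$.
  refine hJ.measure_preimage_eq_zero hf hloc hS'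
    (lebesgueMeasure_eq_zero_of_isLowerDimSubmanifold hS' hS) (fun x hx ↦ ?_) hZ
  have hcont : ContinuousAt (fun y ↦ absDet (mfderiv (𝓡 d) (𝓡 d) f y)) x :=
    continuousAt_absDet_mfderiv (hfS ⟨x, hx⟩)
  exact ⟨_, half_pos (hJ0 x hx), (hcont.eventually (lt_mem_nhds (half_lt_self (hJ0 x hx)))).mono
    fun _ ↦ le_of_lt⟩
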